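/- Let $n\ge 1$ be an integer, let $p>1$ and let $q$ satisfy $\frac1p+\frac1q=1$. Let $f:\mathbb R^n\to\mathbb R$ be a nonzero $C^\infty$ function with compact support. For $\xi\in\mathbb R^n$ put $\nabla_\xi f(x)=\langle\nabla f(x),\xi\rangle$ and $\|\nabla_\xi f\|_p=\big(\int_{\mathbb R^n}|\nabla_\xi f(x)|^p\,dx\big)^{1/p}$. With $d\xi$ the surface measure on the unit sphere $\mathbb S^{n-1}$ (counting measure on $\{\pm1\}$ if $n=1$), define $$C_f^*(x)=\int_{\mathbb S^{n-1}}\|\nabla_\xi f\|_p^{-n-p}\,|\langle x,\xi\rangle|^p\,d\xi,\qquad C_f(x)=\sup_{y\in\mathbb R^n}\{\langle x,y\rangle-C_f^*(y)\},$$ $$K_f=\{x\in\mathbb R^n: C_f(x)\le 1\},\qquad Z_p(f)=\Big(\int_{\mathbb S^{n-1}}\|\nabla_\xi f\|_p^{-n}\,d\xi\Big)^{-1/n}.$$ For real $k\geq 0$ let $\omega_k=\pi^{k/2}/\Gamma(\frac k2+1)$, and put $$a_1=\frac{\omega_{n+p}}{\omega_2\,\omega_n\,\omega_{p-1}},\qquad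 \ell_q=q^{-p/q}\,p^{-1},\qquad a_2=\frac{\ell_q\,n^{(n+p)/n}}{a_1\,(n+p)},$$ $$\mathcal E_p(f)=c_{n,p}\,Z_p(f),\qquad c_{n,p}=(n\omega_n)^{1/n}\Big(\frac{n\,\omega_n\,\omega_{p-1}}{2\,\omega_{n+p-2}}\Big)^{1/p}.$$ Then $$\operatorname{vol}(K_f)^{-p/n}\int_{\mathbb R^n}C_f^*(\nabla f(x))\,dx\;\le\; a_2\,Z_p(f)^p .$$ Moreover, if equality holds, then there is a matrix $M\in\mathbb R^{n\times n}$ with $\det M>0$ such that, with $g(x)=f(M^{-1}x)$, $$\mathcal E_p(f)^p=\det(M)^{\frac{p-n}{n}}\int_{\mathbb R^n}|\nabla g(x)|^p\,dx .$$ -/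

import Mathlib

open MeasureTheory

noncomputable section

namespace AffineSobolev

/-- Volume `ω_k = π^{k/2} / Γ(k/2 + 1)` of the unit ball of `ℝ^k`, for real `k`. -/
def omega (k : ℝ) : ℝ := Real.pi ^ (k / 2) / Real.Gamma (k / 2 + 1)

/-- `‖∇_ξ f‖_p`, the `L^p(ℝⁿ)` norm of the directional derivative `x ↦ ⟨∇f(x), ξ⟩`. -/
def dirNorm {n : ℕ} (p : ℝ) (f : EuclideanSpace ℝ (Fin n) → ℝ)
    (ξ : EuclideanSpace ℝ (Fin n)) : ℝ :=
  (∫ x, |inner ℝ (gradient f x) ξ| ^ p) ^ (1 / p)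

/-- Integral over the unit sphere `S^{n-1}` with respect to its surface measure. -/
def sphereIntegral {n : ℕ} (φ : EuclideanSpace ℝ (Fin n) → ℝ) : ℝ :=
  ∫ ξ : Metric.sphere (0 : EuclideanSpace ℝ (Fin n)) 1, φ ξ
    ∂((volume : Measure (EuclideanSpace ℝ (Fin n))).toSphere)

/-- `C_f^*(x) = ∫_{S^{n-1}} ‖∇_ξ f‖_p^{-n-p} |⟨x, ξ⟩|^p dξ`. -/
def CStar {n : ℕ} (p : ℝ) (f : EuclideanSpace ℝ (Fin n) → ℝ)
    (x : EuclideanSpace ℝ (Fin n)) : ℝ :=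
  sphereIntegral fun ξ => dirNorm p f ξ ^ (-(n : ℝ) - p) * |inner ℝ x ξ| ^ p

/-- The Legendre transform `x ↦ sup_y (⟨x, y⟩ - F y)`. -/
def legendre {n : ℕ} (F : EuclideanSpace ℝ (Fin n) → ℝ)
    (x : EuclideanSpace ℝ (Fin n)) : ℝ :=
  ⨆ y : EuclideanSpace ℝ (Fin n), (inner ℝ x y - F y)

/-- `K_f = {x : C_f(x) ≤ 1}`, where `C_f` is the Legendre transform of `C_f^*`. -/
def K {n : ℕ} (p : ℝ) (f : EuclideanSpace ℝ (Fin n) → ℝ) :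
    Set (EuclideanSpace ℝ (Fin n)) :=
  {x | legendre (CStar p f) x ≤ 1}

/-- `Z_p(f) = (∫_{S^{n-1}} ‖∇_ξ f‖_p^{-n} dξ)^{-1/n}`. -/
def Z {n : ℕ} (p : ℝ) (f : EuclideanSpace ℝ (Fin n) → ℝ) : ℝ :=
  (sphereIntegral fun ξ => dirNorm p f ξ ^ (-(n : ℝ))) ^ (-(1 / (n : ℝ)))

/-- The constant `c_{n,p}` in the affine energy. -/
def c (n : ℕ) (p : ℝ) : ℝ :=
  (n * omega n) ^ (1 / (n : ℝ)) *
    ((n * omega n * omega (p - 1)) / (2 * omega (n + p - 2))) ^ (1 / p)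

/-- The affine energy `E_p(f) = c_{n,p} (∫_{S^{n-1}} ‖∇_ξ f‖_p^{-n} dξ)^{-1/n}`. -/
def affineEnergy {n : ℕ} (p : ℝ) (f : EuclideanSpace ℝ (Fin n) → ℝ) : ℝ :=
  c n p * (sphereIntegral fun ξ => dirNorm p f ξ ^ (-(n : ℝ))) ^ (-(1 / (n : ℝ)))

/-- `a_1 = ω_{n+p} / (ω_2 ω_n ω_{p-1})`. -/
def a₁ (n : ℕ) (p : ℝ) : ℝ := omega (n + p) / (omega 2 * omega n * omega (p - 1))

/-- `ℓ_q = q^{-p/q} p^{-1}`, for conjugate exponents `p` and `q`. -/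
def ell (p q : ℝ) : ℝ := q ^ (-(p / q)) * p⁻¹

/-- `a_2 = ℓ_q n^{(n+p)/n} / (a_1 (n+p))`. -/
def a₂ (n : ℕ) (p q : ℝ) : ℝ :=
  ell p q * (n : ℝ) ^ (((n : ℝ) + p) / n) / (a₁ n p * (n + p))

end AffineSobolev

end

/-! The map ξ ↦ ‖∇_ξ f‖_p is a norm `L`: it is positive off the origin because a compactly supported
function that is constant along a direction vanishes. Let B be its unit ball and ΓB the L_p centroid
body, with support function y ↦ (∫_B |⟨x,y⟩|^p dx)^{1/p}. Polar coordinates give C_f^*(y) = (n+p)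
∫_B |⟨x,y⟩|^p dx and Z_p(f)^{-n} = n vol(B); hence K_f is a dilate of ΓB, while Fubini gives ∫
C_f^*(∇f) = (n+p) ∫_B L^p = n vol(B). After cancellation the claim says that vol(ΓB) /
vol(B)^{(n+p)/p} is at least its value at the Euclidean ball, which is the L_p Busemann-Petty
centroid inequality for symmetric bodies (`centroidRatio_closedBall_le`). In the equality case B =
T(ball) for a linear T, and f ∘ T has directional norms proportional to the Euclidean norm, so the
energy identity becomes a computation.

The centroid inequality and its equality case are proved together by studying minimizers. The ratio
is linearly invariant, so Auerbach's lemma confines the problem to a compact family of norms, and a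
minimizer exists (`exists_minimizer`). Place it in isotropic position and apply Steiner
symmetrization along a unit vector u. The volume of the body is unchanged. By Minkowski's inequality
the support functions h, h' of the old and new centroid bodies satisfy 2h'((y₁-y₂)/2, 1) ≤ h(y₁,1) +
h(y₂,1), so no chord of the centroid body along u gets longer.

Minimality forces equality for some pair y₁, y₂. Strict convexity of t ↦ t^p then puts the midpoints
of the chords of B along u on a hyperplane, and isotropy identifies it with u^⊥. Thus B is invariant
under the reflection in u^⊥ for every u, and is a Euclidean ball. Every minimizer is therefore an
ellipsoid. -/

namespace AffineSobolev

/-! ### Minkowski's inequality in L^p and its equality case -/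

section Lp

variable {X : Type*} [MeasurableSpace X] {μ : Measure X}

lemma memLp_integrable_abs_rpow {p : ℝ} (hp : 1 < p) {φ : X → ℝ}
    (hφ : MemLp φ (ENNReal.ofReal p) μ) : Integrable (fun x => |φ x| ^ p) μ := by
  have h := hφ.integrable_norm_rpow (by simp; linarith) (by simp)
  simpa [ENNReal.toReal_ofReal (by linarith : (0:ℝ) ≤ p)] using h

/-- Minkowski's inequality for real integrals. -/
lemma integral_abs_add_rpow_le {p : ℝ} (hp : 1 < p) {φ ψ : X → ℝ}
    (hφ : MemLp φ (ENNReal.ofReal p) μ) (hψ : MemLp ψ (ENNReal.ofReal p) μ) :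
    (∫ x, |φ x + ψ x| ^ p ∂μ) ^ (1 / p) ≤
      (∫ x, |φ x| ^ p ∂μ) ^ (1 / p) + (∫ x, |ψ x| ^ p ∂μ) ^ (1 / p) := by
  have h := eLpNorm_add_le hφ.1 hψ.1
    (by simpa using hp.le : 1 ≤ ENNReal.ofReal p)
  have h0 : ENNReal.ofReal p ≠ 0 := by simp; linarith
  rw [(hφ.add hψ).eLpNorm_eq_integral_rpow_norm h0 (by simp),
    hφ.eLpNorm_eq_integral_rpow_norm h0 (by simp),
    hψ.eLpNorm_eq_integral_rpow_norm h0 (by simp),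
    ← ENNReal.ofReal_add (by positivity) (by positivity),
    ENNReal.ofReal_le_ofReal_iff (by positivity),
    ENNReal.toReal_ofReal (by linarith : (0:ℝ) ≤ p)] at h
  simpa [one_div] using h

/-- The equality case of Minkowski's inequality. -/
lemma ae_eq_of_integral_abs_add_rpow_ge {p : ℝ} (hp : 1 < p) {φ ψ : X → ℝ}
    (hφ : MemLp φ (ENNReal.ofReal p) μ) (hψ : MemLp ψ (ENNReal.ofReal p) μ) {a b : ℝ}
    (ha : 0 < a) (hb : 0 < b) (hφa : ∫ x, |φ x| ^ p ∂μ = a ^ p)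
    (hψb : ∫ x, |ψ x| ^ p ∂μ = b ^ p)
    (h : (a + b) ^ p ≤ ∫ x, |φ x + ψ x| ^ p ∂μ) :
    ∀ᵐ x ∂μ, b * φ x = a * ψ x := by
  have hp0 : 0 < p := by linarith
  have hsc := strictConvexOn_rpow hp
  have hab : 0 < a + b := by positivity
  -- Convexity of t ↦ t^p at |u|/a and |v|/b with weights a/(a+b) and b/(a+b). Strict convexity
  -- gives |u|/a = |v|/b in case of equality, and equality in the triangle inequality makes the
  -- signs agree.
  have key : ∀ u v : ℝ, |u + v| ^ p ≤
      (a + b) ^ p * (a / (a + b) * (|u| ^ p / a ^ p) + b / (a + b) * (|v| ^ p / b ^ p)) ∧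
      (|u + v| ^ p = (a + b) ^ p *
        (a / (a + b) * (|u| ^ p / a ^ p) + b / (a + b) * (|v| ^ p / b ^ p)) → b * u = a * v) := by
    intro u v
    have e1 : |u| ^ p / a ^ p = (|u| / a) ^ p := by
      rw [Real.div_rpow (abs_nonneg _) ha.le]
    have e2 : |v| ^ p / b ^ p = (|v| / b) ^ p := by
      rw [Real.div_rpow (abs_nonneg _) hb.le]
    have e3 : (a + b) ^ p * ((|u| + |v|) / (a + b)) ^ p = (|u| + |v|) ^ p := by
      rw [← Real.mul_rpow hab.le (by positivity)]; congr 1; field_simp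
    have e4 : (|u| + |v|) / (a + b) =
        a / (a + b) * (|u| / a) + b / (a + b) * (|v| / b) := by field_simp
    have h1 : |u + v| ^ p ≤ (|u| + |v|) ^ p :=
      Real.rpow_le_rpow (abs_nonneg _) (abs_add_le u v) hp0.le
    have hw : a / (a + b) + b / (a + b) = 1 := by field_simp
    have h2 : ((|u| + |v|) / (a + b)) ^ p ≤
        a / (a + b) * (|u| / a) ^ p + b / (a + b) * (|v| / b) ^ p := by
      rw [e4]
      exact hsc.convexOn.2 (Set.mem_Ici.2 (by positivity)) (Set.mem_Ici.2 (by positivity))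
        (by positivity) (by positivity) hw
    have h3 := mul_le_mul_of_nonneg_left h2 (by positivity : 0 ≤ (a + b) ^ p)
    rw [e1, e2]
    refine ⟨by linarith, fun heq => ?_⟩
    have h4 : |u| / a = |v| / b := by
      by_contra hne
      have := hsc.2 (Set.mem_Ici.2 (by positivity : 0 ≤ |u| / a))
        (Set.mem_Ici.2 (by positivity : 0 ≤ |v| / b)) hne
        (by positivity : 0 < a / (a + b)) (by positivity : 0 < b / (a + b)) hw
      simp only [smul_eq_mul] at this
      rw [← e4] at this
      have := mul_lt_mul_of_pos_left this (by positivity : 0 < (a + b) ^ p)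
      linarith
    have h5 : |u + v| ^ p = (|u| + |v|) ^ p := le_antisymm h1 (by linarith)
    have h6 : |u + v| = |u| + |v| :=
      (Real.rpow_left_inj (abs_nonneg _) (by positivity) hp0.ne').1 h5
    rw [div_eq_div_iff ha.ne' hb.ne'] at h4
    rcases abs_add_eq_add_abs_iff u v |>.1 h6 with ⟨h7, h8⟩ | ⟨h7, h8⟩
    · rw [abs_of_nonneg h7, abs_of_nonneg h8] at h4; linarith
    · rw [abs_of_nonpos h7, abs_of_nonpos h8] at h4; linarith
  have iφ := memLp_integrable_abs_rpow hp hφ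
  have iψ := memLp_integrable_abs_rpow hp hψ
  have iφψ := memLp_integrable_abs_rpow hp (hφ.add hψ)
  have ig : Integrable (fun x => (a + b) ^ p *
      (a / (a + b) * (|φ x| ^ p / a ^ p) + b / (a + b) * (|ψ x| ^ p / b ^ p))) μ :=
    (((iφ.div_const _).const_mul _).add ((iψ.div_const _).const_mul _)).const_mul _
  -- The pointwise majorant integrates to exactly (a+b)^p, so the hypothesis `h` forces pointwise
  -- equality almost everywhere.
  have hint : ∫ x, (a + b) ^ p *
      (a / (a + b) * (|φ x| ^ p / a ^ p) + b / (a + b) * (|ψ x| ^ p / b ^ p)) ∂μ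
      = (a + b) ^ p := by
    rw [integral_const_mul, integral_add ((iφ.div_const _).const_mul _)
      ((iψ.div_const _).const_mul _), integral_const_mul, integral_const_mul,
      integral_div, integral_div, hφa, hψb, div_self (by positivity), div_self (by positivity)]
    field_simp
  have hle : (fun x => |φ x + ψ x| ^ p) ≤ᵐ[μ] fun x => (a + b) ^ p *
      (a / (a + b) * (|φ x| ^ p / a ^ p) + b / (a + b) * (|ψ x| ^ p / b ^ p)) :=
    .of_forall fun x => (key _ _).1
  have heq := (integral_eq_iff_of_ae_le iφψ ig hle).1
    (le_antisymm (integral_mono_ae iφψ ig hle) (by rw [hint]; exact h))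
  filter_upwards [heq] with x hx using (key _ _).2 hx

variable {E : Type*} [NormedAddCommGroup E] [InnerProductSpace ℝ E]

/-- The seminorm `y ↦ (∫ |⟨g x, y⟩|^p dμ(x))^{1/p}`. -/
noncomputable def lpSeminorm {p : ℝ} (hp : 1 < p) (μ : Measure X) (g : X → E)
    (hg : ∀ y, MemLp (fun x => inner ℝ (g x) y) (ENNReal.ofReal p) μ) : Seminorm ℝ E :=
  Seminorm.of (fun y => (∫ x, |inner ℝ (g x) y| ^ p ∂μ) ^ (1 / p))
    (fun y z => by
      simp only [inner_add_right]
      exact integral_abs_add_rpow_le hp (hg y) (hg z))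
    (fun c y => by
      have hp0 : p ≠ 0 := by linarith
      simp only [inner_smul_right, abs_mul]
      have : ∀ x, (|c| * |inner ℝ (g x) y|) ^ p = |c| ^ p * |inner ℝ (g x) y| ^ p := fun x =>
        Real.mul_rpow (abs_nonneg _) (abs_nonneg _)
      simp only [this]
      rw [integral_const_mul, Real.mul_rpow (by positivity) (by positivity),
        one_div, Real.rpow_rpow_inv (abs_nonneg _) hp0, Real.norm_eq_abs])

lemma lpSeminorm_apply {p : ℝ} (hp : 1 < p) (g : X → E)
    (hg : ∀ y, MemLp (fun x => inner ℝ (g x) y) (ENNReal.ofReal p) μ) (y : E) :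
    lpSeminorm hp μ g hg y = (∫ x, |inner ℝ (g x) y| ^ p ∂μ) ^ (1 / p) := rfl

end Lp

/-! ### Comparison of seminorms with the Euclidean norm in finite dimension -/

section Norms

variable {E : Type*} [NormedAddCommGroup E] [NormedSpace ℝ E] [FiniteDimensional ℝ E]

lemma seminorm_continuous (L : Seminorm ℝ E) : Continuous L :=
  continuousOn_univ.1 (L.convexOn.continuousOn isOpen_univ)

lemma exists_seminorm_le (L : Seminorm ℝ E) : ∃ R, 0 < R ∧ ∀ x, L x ≤ R * ‖x‖ := by
  obtain ⟨C, hC⟩ := (isCompact_sphere (0 : E) 1).bddAbove_image (seminorm_continuous L).continuousOn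
  refine ⟨max C 1, by positivity, fun x => ?_⟩
  rcases eq_or_ne x 0 with rfl | hx
  · simp
  have hx' : 0 < ‖x‖ := norm_pos_iff.2 hx
  have h : L (‖x‖⁻¹ • x) ≤ C := hC ⟨_, by simp [norm_smul, hx], rfl⟩
  rw [map_smul_eq_mul, norm_inv, norm_norm, inv_mul_le_iff₀ hx'] at h
  nlinarith [le_max_left C 1]

lemma exists_le_seminorm (L : Seminorm ℝ E) (hL : ∀ x ≠ 0, 0 < L x) :
    ∃ r, 0 < r ∧ ∀ x, r * ‖x‖ ≤ L x := by
  rcases subsingleton_or_nontrivial E with h | h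
  · exact ⟨1, one_pos, fun x => by simp [Subsingleton.elim x 0]⟩
  obtain ⟨z, hz, hmin⟩ := (isCompact_sphere (0 : E) 1).exists_isMinOn
    (NormedSpace.sphere_nonempty.2 zero_le_one) (seminorm_continuous L).continuousOn
  have hz0 : z ≠ 0 := by rintro rfl; simp at hz
  refine ⟨L z, hL z hz0, fun x => ?_⟩
  rcases eq_or_ne x 0 with rfl | hx
  · simp
  have hx' : 0 < ‖x‖ := norm_pos_iff.2 hx
  have h : L z ≤ L (‖x‖⁻¹ • x) := hmin (by simp [norm_smul, hx])
  rwa [map_smul_eq_mul, norm_inv, norm_norm, le_inv_mul_iff₀ hx', mul_comm] at h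

end Norms

end AffineSobolev

/-! ### L_p centroid bodies and the linear invariance of the centroid ratio -/

namespace AffineSobolev

open scoped Topology

variable {E : Type*} [NormedAddCommGroup E] [InnerProductSpace ℝ E] [FiniteDimensional ℝ E]
  [MeasurableSpace E] [BorelSpace E]

/-- The unit ball `{x | L x ≤ 1}` of a function. -/
def unitBody (L : E → ℝ) : Set E := {x | L x ≤ 1}

/-- The `p`-th moment `∫_A |⟨x, y⟩|^p dx` of a set in direction `y`. -/
noncomputable def moment (p : ℝ) (A : Set E) (y : E) : ℝ := ∫ x in A, |inner ℝ x y| ^ p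

/-- The (non-normalized) `L_p` centroid body of a set. -/
def centroidBody (p : ℝ) (A : Set E) : Set E := {x | ∀ y, inner ℝ x y ≤ moment p A y ^ (1 / p)}

/-- The linearly invariant ratio of the `L_p` Busemann-Petty centroid inequality. -/
noncomputable def centroidRatio (p : ℝ) (A : Set E) : ℝ :=
  volume.real (centroidBody p A) / volume.real A ^ ((Module.finrank ℝ E + p) / p)

lemma memLp_inner_of_isCompact {A : Set E} (hA : IsCompact A) (q : ENNReal) (y : E) :
    MemLp (fun x => inner ℝ x y) q (volume.restrict A) := by
  obtain ⟨C, hC⟩ := hA.exists_bound_of_continuousOn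
    (f := fun x => inner ℝ x y) (by fun_prop)
  have : IsFiniteMeasure (volume.restrict A) := ⟨by simpa using hA.measure_lt_top⟩
  refine MemLp.of_bound (by fun_prop) C ?_
  filter_upwards [ae_restrict_mem hA.measurableSet] with x hx using hC x hx

lemma integrableOn_moment {p : ℝ} (hp : 1 < p) {A : Set E} (hA : IsCompact A) (y : E) :
    IntegrableOn (fun x => |inner ℝ x y| ^ p) A :=
  memLp_integrable_abs_rpow hp (memLp_inner_of_isCompact hA _ y)

lemma moment_nonneg (p : ℝ) (A : Set E) (y : E) : 0 ≤ moment p A y :=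
  integral_nonneg fun _ => by positivity

lemma moment_mono {p : ℝ} (hp : 1 < p) {A B : Set E} (hB : IsCompact B)
    (h : A ⊆ B) (y : E) : moment p A y ≤ moment p B y :=
  setIntegral_mono_set (integrableOn_moment hp hB y) (.of_forall fun _ => by positivity)
    (.of_forall h)

lemma centroidBody_mono {p : ℝ} (hp : 1 < p) {A B : Set E} (hB : IsCompact B)
    (h : A ⊆ B) : centroidBody p A ⊆ centroidBody p B := fun x hx y =>
  (hx y).trans (Real.rpow_le_rpow (moment_nonneg _ _ _) (moment_mono hp hB h y)
    (by positivity))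

/-- The support function of the `L_p` centroid body, as a seminorm. -/
noncomputable def momentSeminorm {p : ℝ} (hp : 1 < p) {A : Set E} (hA : IsCompact A) :
    Seminorm ℝ E :=
  lpSeminorm hp (volume.restrict A) id fun y => memLp_inner_of_isCompact hA _ y

lemma momentSeminorm_apply {p : ℝ} (hp : 1 < p) {A : Set E} (hA : IsCompact A) (y : E) :
    momentSeminorm hp hA y = moment p A y ^ (1 / p) := rfl

/-- The integrand is nonzero on the open set of interior points of `A` off the hyperplane y^⊥; this
set contains small positive multiples of `y`. -/
lemma moment_pos {p : ℝ} (hp : 1 < p) {A : Set E} (hA : IsCompact A) (h0 : A ∈ 𝓝 0) {y : E}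
    (hy : y ≠ 0) : 0 < moment p A y := by
  rw [moment, setIntegral_pos_iff_support_of_nonneg_ae (.of_forall fun _ => by positivity)
    (integrableOn_moment hp hA y)]
  have h1 : IsOpen ({x : E | inner ℝ x y ≠ 0} ∩ interior A) :=
    (isOpen_ne_fun (by fun_prop) continuous_const).inter isOpen_interior
  refine (h1.measure_pos volume ?_).trans_le (measure_mono ?_)
  · have ht : Filter.Tendsto (fun t : ℝ => t • y) (𝓝[>] 0) (𝓝 0) := by
      have : Filter.Tendsto (fun t : ℝ => t • y) (𝓝 0) (𝓝 ((0:ℝ) • y)) :=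
        (continuous_id.smul continuous_const).tendsto 0
      rw [zero_smul] at this
      exact this.mono_left nhdsWithin_le_nhds
    obtain ⟨t, ht1, ht2⟩ := ((ht.eventually (interior_mem_nhds.2 h0)).and
      self_mem_nhdsWithin).exists
    refine ⟨t • y, ?_, ht1⟩
    have : (0:ℝ) < t := ht2
    simp [inner_smul_left, hy, this.ne']
  · rintro x ⟨hx1, hx2⟩
    refine ⟨?_, interior_subset hx2⟩
    have : 0 < |(inner ℝ x y : ℝ)| := abs_pos.2 hx1
    exact (Real.rpow_pos_of_pos this p).ne'

lemma moment_rpow_inv_pos {p : ℝ} (hp : 1 < p) {A : Set E} (hA : IsCompact A) (h0 : A ∈ 𝓝 0) :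
    ∀ y ≠ 0, 0 < momentSeminorm hp hA y := fun _ hy =>
  Real.rpow_pos_of_pos (moment_pos hp hA h0 hy) _

lemma moment_eq_rpow {p : ℝ} (hp : 1 < p) {A : Set E} (hA : IsCompact A) (y : E) :
    moment p A y = momentSeminorm hp hA y ^ p := by
  rw [momentSeminorm_apply, one_div, Real.rpow_inv_rpow (moment_nonneg _ _ _) (by linarith)]

lemma isCompact_centroidBody {p : ℝ} (hp : 1 < p) {A : Set E} (hA : IsCompact A) :
    IsCompact (centroidBody p A) := by
  obtain ⟨R, hR, h⟩ := exists_seminorm_le (momentSeminorm hp hA)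
  refine Metric.isCompact_of_isClosed_isBounded ?_ ?_
  · simp only [centroidBody, Set.ofPred_forall]
    exact isClosed_iInter fun y => isClosed_le (by fun_prop) continuous_const
  · refine (Metric.isBounded_closedBall (x := (0:E)) (r := R)).subset fun x hx => ?_
    have h1 := (hx x).trans (h x)
    rw [real_inner_self_eq_norm_sq] at h1
    rw [mem_closedBall_zero_iff]
    by_contra! hlt
    nlinarith [norm_nonneg x]

lemma centroidBody_mem_nhds {p : ℝ} (hp : 1 < p) {A : Set E} (hA : IsCompact A) (h0 : A ∈ 𝓝 0) :
    centroidBody p A ∈ 𝓝 0 := by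
  obtain ⟨r, hr, h⟩ := exists_le_seminorm _ (moment_rpow_inv_pos hp hA h0)
  refine Filter.mem_of_superset (Metric.closedBall_mem_nhds _ hr) fun x hx y => ?_
  rw [mem_closedBall_zero_iff] at hx
  exact (real_inner_le_norm x y).trans ((mul_le_mul_of_nonneg_right hx (norm_nonneg y)).trans (h y))

lemma measureReal_pos_of_mem_nhds {A : Set E} (hA : IsCompact A) (h0 : A ∈ 𝓝 0) :
    0 < volume.real A :=
  ENNReal.toReal_pos (Measure.measure_pos_of_mem_nhds _ h0).ne' hA.measure_lt_top.ne

omit [MeasurableSpace E] [BorelSpace E] in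
lemma isCompact_unitBody {L : Seminorm ℝ E} (hL : ∀ x ≠ 0, 0 < L x) :
    IsCompact (unitBody L) := by
  obtain ⟨r, hr, h⟩ := exists_le_seminorm L hL
  refine Metric.isCompact_of_isClosed_isBounded
    (isClosed_le (seminorm_continuous L) continuous_const) ?_
  refine (Metric.isBounded_closedBall (x := (0:E)) (r := r⁻¹)).subset fun x hx => ?_
  rw [mem_closedBall_zero_iff]
  have := (h x).trans hx
  rw [← one_div, le_div_iff₀ hr]
  linarith

omit [MeasurableSpace E] [BorelSpace E] in
lemma unitBody_mem_nhds (L : Seminorm ℝ E) : unitBody L ∈ 𝓝 0 := by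
  have : IsOpen {x | L x < 1} := isOpen_lt (seminorm_continuous L) continuous_const
  exact Filter.mem_of_superset (this.mem_nhds (by simp)) fun x hx =>
    (show L x < 1 from hx).le

lemma measureReal_preimage_linear (T : E ≃ₗ[ℝ] E) (s : Set E) :
    volume.real (T ⁻¹' s) = |LinearMap.det (T : E →ₗ[ℝ] E)|⁻¹ * volume.real s := by
  rw [Measure.real, Measure.addHaar_preimage_linearEquiv, ENNReal.toReal_mul,
    ENNReal.toReal_ofReal (abs_nonneg _), Measure.real, ← abs_inv, LinearEquiv.det_coe_symm]

lemma integral_comp_linear {F : Type*} [NormedAddCommGroup F] [NormedSpace ℝ F]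
    (T : E ≃ₗ[ℝ] E) (φ : E → F) :
    ∫ x, φ (T x) = |LinearMap.det (T : E →ₗ[ℝ] E)|⁻¹ • ∫ x, φ x := by
  have hemb : MeasurableEmbedding T :=
    T.toContinuousLinearEquiv.toHomeomorph.measurableEmbedding
  have h := Measure.map_linearMap_addHaar_eq_smul_addHaar (volume : Measure E)
    (f := (T : E →ₗ[ℝ] E)) (LinearEquiv.isUnit_det' T).ne_zero
  rw [← hemb.integral_map]
  change ∫ x, φ x ∂(Measure.map (T : E →ₗ[ℝ] E) volume) = _
  rw [h, integral_smul_measure, ENNReal.toReal_ofReal (abs_nonneg _), abs_inv]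

lemma setIntegral_preimage_linear (T : E ≃ₗ[ℝ] E) {A : Set E} (hA : MeasurableSet A) (φ : E → ℝ) :
    ∫ x in T ⁻¹' A, φ (T x) = |LinearMap.det (T : E →ₗ[ℝ] E)|⁻¹ * ∫ x in A, φ x := by
  have hT : Measurable T := T.toContinuousLinearEquiv.continuous.measurable
  rw [← integral_indicator hA, ← integral_indicator (hT hA), ← smul_eq_mul,
    ← integral_comp_linear]
  rfl

lemma moment_preimage (p : ℝ) (T : E ≃ₗ[ℝ] E) {A : Set E} (hA : MeasurableSet A) (y : E) :
    moment p (T ⁻¹' A) (LinearMap.adjoint (T : E →ₗ[ℝ] E) y) =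
      |LinearMap.det (T : E →ₗ[ℝ] E)|⁻¹ * moment p A y := by
  rw [moment, moment, ← setIntegral_preimage_linear T hA]
  simp [LinearMap.adjoint_inner_right]

omit [MeasurableSpace E] [BorelSpace E] in
lemma adjoint_surjective (T : E ≃ₗ[ℝ] E) :
    Function.Surjective (LinearMap.adjoint (T : E →ₗ[ℝ] E)) := fun y => by
  refine ⟨LinearMap.adjoint (T.symm : E →ₗ[ℝ] E) y, ?_⟩
  rw [← LinearMap.comp_apply, ← LinearMap.adjoint_comp]
  simp

/-- Every test vector may be written T^*y. The moment in that direction changes only by |det T|⁻¹,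
which becomes a dilation by |det T|^{1/p} after the p-th root. -/
lemma mem_centroidBody_preimage (p : ℝ) (T : E ≃ₗ[ℝ] E) {A : Set E}
    (hA : MeasurableSet A) (x : E) :
    x ∈ centroidBody p (T ⁻¹' A) ↔
      |LinearMap.det (T : E →ₗ[ℝ] E)| ^ (1 / p) • T x ∈ centroidBody p A := by
  have hd : 0 < |LinearMap.det (T : E →ₗ[ℝ] E)| := abs_pos.2 (LinearEquiv.isUnit_det' T).ne_zero
  simp only [centroidBody, Set.mem_ofPred_eq]
  rw [(adjoint_surjective T).forall]
  refine forall_congr' fun y => ?_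
  rw [moment_preimage p T hA, LinearMap.adjoint_inner_right, inner_smul_left,
    Real.mul_rpow (by positivity) (moment_nonneg _ _ _), Real.inv_rpow hd.le,
    le_inv_mul_iff₀ (by positivity)]
  rfl

lemma measureReal_centroidBody_preimage {p : ℝ} (hp : 1 < p) (T : E ≃ₗ[ℝ] E) {A : Set E}
    (hA : MeasurableSet A) :
    volume.real (centroidBody p (T ⁻¹' A)) =
      (|LinearMap.det (T : E →ₗ[ℝ] E)|⁻¹) ^ ((Module.finrank ℝ E + p) / p) *
        volume.real (centroidBody p A) := by
  set d := |LinearMap.det (T : E →ₗ[ℝ] E)| with hdef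
  have hd : 0 < d := abs_pos.2 (LinearEquiv.isUnit_det' T).ne_zero
  have hc : d ^ (1 / p) ≠ 0 := by positivity
  -- The factor d⁻¹ comes from `T` and d^{-n/p} from the dilation; together they give the exponent
  -- (n+p)/p.
  have h1 : centroidBody p (T ⁻¹' A) =
      T ⁻¹' ((LinearEquiv.smulOfNeZero ℝ E _ hc) ⁻¹' centroidBody p A) := by
    ext x
    rw [mem_centroidBody_preimage p T hA]
    rfl
  have h2 : LinearMap.det ((LinearEquiv.smulOfNeZero ℝ E _ hc : E ≃ₗ[ℝ] E) : E →ₗ[ℝ] E) =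
      (d ^ (1 / p)) ^ (Module.finrank ℝ E) := by
    have : ((LinearEquiv.smulOfNeZero ℝ E _ hc : E ≃ₗ[ℝ] E) : E →ₗ[ℝ] E) =
        (d ^ (1 / p)) • LinearMap.id := by ext; rfl
    rw [this, LinearMap.det_smul, LinearMap.det_id, mul_one]
  rw [h1, measureReal_preimage_linear, measureReal_preimage_linear, h2, ← hdef, ← mul_assoc]
  congr 1
  rw [abs_of_pos (by positivity), ← Real.rpow_natCast, ← Real.rpow_mul hd.le, Real.inv_rpow hd.le,
    ← mul_inv]
  congr 1
  nth_rewrite 1 [← Real.rpow_one d]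
  rw [← Real.rpow_add hd]
  congr 1
  field_simp
  ring

/-- The centroid ratio is invariant under linear maps. -/
lemma centroidRatio_preimage {p : ℝ} (hp : 1 < p) (T : E ≃ₗ[ℝ] E) {A : Set E}
    (hA : MeasurableSet A) : centroidRatio p (T ⁻¹' A) = centroidRatio p A := by
  have hd : 0 < |LinearMap.det (T : E →ₗ[ℝ] E)|⁻¹ :=
    inv_pos.2 (abs_pos.2 (LinearEquiv.isUnit_det' T).ne_zero)
  rw [centroidRatio, centroidRatio, measureReal_centroidBody_preimage hp T hA,
    measureReal_preimage_linear, Real.mul_rpow hd.le measureReal_nonneg,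
    mul_div_mul_left _ _ (by positivity)]

/-- The centroid ratio is continuous for the multiplicative distance of bodies. -/
lemma centroidRatio_le_of_subset {p : ℝ} (hp : 1 < p) {A B : Set E}
    (hA : IsCompact A) (hB : IsCompact B) (hA0 : A ∈ 𝓝 0) (hB0 : B ∈ 𝓝 0) {t : ℝ} (ht : 0 < t)
    (h1 : ∀ x ∈ A, t⁻¹ • x ∈ B) (h2 : ∀ x ∈ B, t⁻¹ • x ∈ A) :
    centroidRatio p A ≤
      (t ^ Module.finrank ℝ E) ^ (2 * ((Module.finrank ℝ E + p) / p)) * centroidRatio p B := by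
  have ht' : t⁻¹ ≠ 0 := by positivity
  -- With this dilation the inclusions read A ⊆ S⁻¹(B) and B ⊆ S⁻¹(A). The first bounds the
  -- numerator and the second the denominator, each at the cost of the same factor, whence the 2 in
  -- the exponent.
  set S := LinearEquiv.smulOfNeZero ℝ E _ ht' with hS
  have hdet : |LinearMap.det (S : E →ₗ[ℝ] E)|⁻¹ = t ^ (Module.finrank ℝ E) := by
    have : (S : E →ₗ[ℝ] E) = t⁻¹ • LinearMap.id := by ext; rfl
    rw [this, LinearMap.det_smul, LinearMap.det_id, mul_one, abs_of_pos (by positivity), inv_pow,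
      inv_inv]
  have hScont : Continuous S := S.toContinuousLinearEquiv.continuous
  have cpt : ∀ C : Set E, IsCompact C → IsCompact (S ⁻¹' C) := fun C hC =>
    (S.toContinuousLinearEquiv.toHomeomorph.isCompact_preimage).2 hC
  have e1 : volume.real (centroidBody p A) ≤ (t ^ Module.finrank ℝ E) ^
      ((Module.finrank ℝ E + p) / p) * volume.real (centroidBody p B) := by
    rw [← hdet, ← measureReal_centroidBody_preimage hp S hB.measurableSet]
    exact measureReal_mono (centroidBody_mono hp (cpt B hB) fun x hx => h1 x hx)
      (isCompact_centroidBody hp (cpt B hB)).measure_lt_top.ne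
  have e2 : volume.real B ≤ t ^ Module.finrank ℝ E * volume.real A := by
    rw [← hdet, ← measureReal_preimage_linear]
    exact measureReal_mono (fun x hx => h2 x hx) (cpt A hA).measure_lt_top.ne
  have hvA := measureReal_pos_of_mem_nhds hA hA0
  have hvB := measureReal_pos_of_mem_nhds hB hB0
  have e3 : volume.real B ^ ((Module.finrank ℝ E + p) / p) ≤ (t ^ Module.finrank ℝ E) ^
      ((Module.finrank ℝ E + p) / p) * volume.real A ^ ((Module.finrank ℝ E + p) / p) := by
    rw [← Real.mul_rpow (by positivity) hvA.le]
    exact Real.rpow_le_rpow hvB.le e2 (by positivity)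
  rw [centroidRatio, centroidRatio, two_mul, Real.rpow_add (by positivity), ← mul_div_assoc,
    div_le_div_iff₀ (by positivity) (by positivity)]
  set τ := (t ^ Module.finrank ℝ E) ^ ((Module.finrank ℝ E + p) / p) with hτ
  have hτ0 : 0 < τ := by positivity
  calc _ ≤ (τ * volume.real (centroidBody p B)) * (τ * volume.real A ^ ((Module.finrank ℝ E + p) / p)) :=
        mul_le_mul e1 e3 (by positivity) (by positivity)
    _ = _ := by ring

lemma centroidRatio_pos {p : ℝ} (hp : 1 < p) {A : Set E} (hA : IsCompact A) (h0 : A ∈ 𝓝 0) :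
    0 < centroidRatio p A :=
  div_pos (measureReal_pos_of_mem_nhds (isCompact_centroidBody hp hA)
    (centroidBody_mem_nhds hp hA h0))
    (Real.rpow_pos_of_pos (measureReal_pos_of_mem_nhds hA h0) _)

end AffineSobolev

/-! ### Existence of a minimizer of the centroid ratio -/

namespace AffineSobolev

open scoped Topology

variable {n : ℕ}

/-- Auerbach's lemma: after a linear change of variables, every norm lies between the
maximum norm and the sum norm. -/
lemma exists_auerbach (L : Seminorm ℝ (EuclideanSpace ℝ (Fin n))) (hL : ∀ x ≠ 0, 0 < L x) :
    ∃ T : EuclideanSpace ℝ (Fin n) ≃ₗ[ℝ] EuclideanSpace ℝ (Fin n),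
      ∀ x, (∀ i, |x i| ≤ L (T x)) ∧ L (T x) ≤ ∑ i, |x i| := by
  set mat : (Fin n → EuclideanSpace ℝ (Fin n)) → Matrix (Fin n) (Fin n) ℝ :=
    fun v => Matrix.of fun i j => v j i with hmat
  have hcpt : IsCompact (Set.univ.pi fun _ : Fin n => unitBody L) :=
    isCompact_univ_pi fun _ => isCompact_unitBody hL
  have hcont : Continuous fun v => (mat v).det := by
    refine Continuous.matrix_det ?_
    refine continuous_matrix fun i j => ?_
    simp only [hmat, Matrix.of_apply]
    fun_prop
  -- The Auerbach basis consists of the columns of largest determinant among n-tuples in the unit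
  -- ball of `L`.
  obtain ⟨v, hv, hmax⟩ := hcpt.exists_isMaxOn
    ⟨0, fun i _ => by simp [unitBody]⟩ hcont.continuousOn
  have hv' : ∀ i, L (v i) ≤ 1 := fun i => hv i trivial
  have hpos : 0 < (mat v).det := by
    obtain ⟨R, hR, hLR⟩ := exists_seminorm_le L
    refine lt_of_lt_of_le ?_ (hmax (a := fun i => R⁻¹ • EuclideanSpace.single i (1:ℝ)) ?_)
    · have : mat (fun i => R⁻¹ • EuclideanSpace.single i (1:ℝ)) = R⁻¹ • (1 : Matrix _ _ ℝ) := by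
        ext i j
        simp [hmat, Matrix.one_apply]
      simp only [this, Matrix.det_smul, Matrix.det_one]
      positivity
    · intro i _
      refine (hLR _).trans ?_
      rw [norm_smul, norm_inv, Real.norm_of_nonneg hR.le]
      simp [hR.ne']
  have hTx : ∀ x, Matrix.toEuclideanLin (mat v) x = ∑ j, x j • v j := by
    intro x
    ext i
    simp [Matrix.mulVec, dotProduct, hmat, mul_comm]
  have hup : ∀ x, L (Matrix.toEuclideanLin (mat v) x) ≤ ∑ i, |x i| := by
    intro x
    rw [hTx]
    refine (Finset.le_sum_of_subadditive L (map_zero L).le (map_add_le_add L) _ _).trans ?_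
    refine Finset.sum_le_sum fun i _ => ?_
    rw [map_smul_eq_mul, Real.norm_eq_abs]
    nlinarith [abs_nonneg (x i), hv' i]
  have hone : ∀ x, L (Matrix.toEuclideanLin (mat v) x) ≤ 1 → ∀ i, |x i| ≤ 1 := by
    have haux : ∀ x, L (Matrix.toEuclideanLin (mat v) x) ≤ 1 → ∀ i, x i ≤ 1 := by
      intro x hx i
      have h1 : (Matrix.cramer (mat v)) ((mat v).mulVec x) i = (mat v).det * x i := by
        rw [Matrix.cramer_eq_adjugate_mulVec, Matrix.mulVec_mulVec, Matrix.adjugate_mul,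
          Matrix.smul_mulVec, Matrix.one_mulVec]
        rfl
      -- By Cramer's rule, replacing the i-th column by the image of `x` multiplies the determinant
      -- by `x i`. Maximality then gives x i ≤ 1.
      have h2 : (mat v).updateCol i ((mat v).mulVec x) =
          mat (Function.update v i (Matrix.toEuclideanLin (mat v) x)) := by
        ext k l
        by_cases h : l = i
        · subst h; simp [hmat]
        · simp [hmat, h]
      have h3 := hmax (a := Function.update v i (Matrix.toEuclideanLin (mat v) x)) (by
        intro k _
        by_cases h : k = i
        · subst h; simpa [unitBody] using hx
        · simpa [unitBody, h] using hv' k)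
      simp only [Set.mem_ofPred_eq] at h3
      rw [← h2, ← Matrix.cramer_apply, h1] at h3
      nlinarith
    intro x hx i
    refine abs_le.2 ⟨?_, haux x hx i⟩
    have := haux (-x) (by rwa [map_neg, map_neg_eq_map]) i
    simp at this
    linarith
  have hlow : ∀ x i, |x i| ≤ L (Matrix.toEuclideanLin (mat v) x) := by
    intro x i
    have h0 := apply_nonneg L (Matrix.toEuclideanLin (mat v) x)
    by_contra! hlt
    obtain ⟨s, hs1, hs2⟩ := exists_between hlt
    have hs : 0 < s := h0.trans_lt hs1
    have := hone (s⁻¹ • x) (by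
      rw [map_smul, map_smul_eq_mul, norm_inv, Real.norm_of_nonneg hs.le, inv_mul_le_iff₀ hs]
      linarith) i
    simp only [PiLp.smul_apply, smul_eq_mul, abs_mul, abs_inv, abs_of_pos hs] at this
    rw [inv_mul_le_iff₀ hs] at this
    linarith
  have hinj : Function.Injective (Matrix.toEuclideanLin (mat v)) := by
    rw [injective_iff_map_eq_zero]
    intro x hx
    ext i
    have := hlow x i
    rw [hx, map_zero] at this
    simpa using this
  exact ⟨LinearEquiv.ofInjectiveEndo _ hinj, fun x => ⟨fun i => hlow x i, hup x⟩⟩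

/-- The norms lying between the maximum norm and the sum norm. -/
def normalizedNorms (n : ℕ) : Set (EuclideanSpace ℝ (Fin n) → ℝ) :=
  {φ | (∀ x y, φ (x + y) ≤ φ x + φ y) ∧ (∀ (c : ℝ) x, φ (c • x) = ‖c‖ * φ x) ∧
    ∀ x, (∀ i, |x i| ≤ φ x) ∧ φ x ≤ ∑ i, |x i|}

/-- In the topology of pointwise convergence this is a closed subset of a product of compact
intervals, so Tychonoff's theorem applies. The lower bound by the maximum norm keeps limits from
degenerating. -/
lemma isCompact_normalizedNorms : IsCompact (normalizedNorms n) := by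
  refine (isCompact_univ_pi fun x : EuclideanSpace ℝ (Fin n) =>
    (isCompact_Icc : IsCompact (Set.Icc 0 (∑ i, |x i|)))).of_isClosed_subset ?_ ?_
  · simp only [normalizedNorms, Set.ofPred_and, Set.ofPred_forall]
    refine .inter ?_ (.inter ?_ ?_)
    · exact isClosed_iInter fun x => isClosed_iInter fun y =>
        isClosed_le (by fun_prop) (by fun_prop)
    · exact isClosed_iInter fun x => isClosed_iInter fun y =>
        isClosed_eq (by fun_prop) (by fun_prop)
    · exact isClosed_iInter fun x => .inter (isClosed_iInter fun i =>
        isClosed_le (by fun_prop) (by fun_prop)) (isClosed_le (by fun_prop) (by fun_prop))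
  · rintro φ ⟨-, h1, h2⟩ x -
    refine ⟨?_, (h2 x).2⟩
    rcases isEmpty_or_nonempty (Fin n) with h | ⟨⟨i⟩⟩
    · have : x = (0:ℝ) • x := by ext i; exact h.elim i
      rw [this, h1]; simp
    · exact (abs_nonneg _).trans ((h2 x).1 i)

/-- A normalized norm as a seminorm. -/
noncomputable def normalizedSeminorm {φ : EuclideanSpace ℝ (Fin n) → ℝ}
    (h : φ ∈ normalizedNorms n) : Seminorm ℝ (EuclideanSpace ℝ (Fin n)) :=
  Seminorm.of φ h.1 h.2.1

lemma normalizedSeminorm_pos {φ : EuclideanSpace ℝ (Fin n) → ℝ}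
    (h : φ ∈ normalizedNorms n) : ∀ x ≠ 0, 0 < normalizedSeminorm h x := by
  intro x hx
  have : ∃ i, x i ≠ 0 := by
    by_contra! hc
    exact hx (by ext i; exact hc i)
  obtain ⟨i, hi⟩ := this
  exact (abs_pos.2 hi).trans_le ((h.2.2 x).1 i)

lemma normalizedNorms_sub_le {φ : EuclideanSpace ℝ (Fin n) → ℝ}
    (h : φ ∈ normalizedNorms n) (x z : EuclideanSpace ℝ (Fin n)) :
    |φ x - φ z| ≤ ∑ i, |x i - z i| :=
  (abs_sub_map_le_sub (normalizedSeminorm h) x z).trans (h.2.2 (x - z)).2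

/-- Normalized norms are equi-Lipschitz, so pointwise closeness on a finite net is uniform closeness
on the cube. The unit balls then agree up to a dilation factor t close to 1, and
`centroidRatio_le_of_subset` applies. -/
lemma lowerSemicontinuousOn_centroidRatio {p : ℝ} (hp : 1 < p) :
    LowerSemicontinuousOn (fun φ => centroidRatio p (unitBody φ)) (normalizedNorms n) := by
  intro φ hφ y hy
  set C := 2 * ((Module.finrank ℝ (EuclideanSpace ℝ (Fin n)) + p) / p)
  set d := Module.finrank ℝ (EuclideanSpace ℝ (Fin n))
  have hcont : ContinuousAt (fun t : ℝ => (t ^ d) ^ C * y) 1 := by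
    refine ContinuousAt.mul (ContinuousAt.rpow_const (by fun_prop) (by simp)) continuousAt_const
  have hev : ∀ᶠ t in 𝓝[>] (1:ℝ), (t ^ d) ^ C * y < centroidRatio p (unitBody φ) :=
    (hcont.eventually_lt continuousAt_const (by simpa using hy)).filter_mono nhdsWithin_le_nhds
  obtain ⟨t, ht, ht1⟩ := (hev.and self_mem_nhdsWithin).exists
  have ht1 : (1:ℝ) < t := ht1
  -- A third of the tolerance goes to each of the Lipschitz error of φ, that of ψ, and the
  -- difference at a net point.
  set δ := (t - 1) / 3 with hδ
  have hδ0 : 0 < δ := by rw [hδ]; linarith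
  set Q : Set (EuclideanSpace ℝ (Fin n)) := unitBody φ
  have hsum : ∀ z, {x : EuclideanSpace ℝ (Fin n) | ∑ i, |x i - z i| < δ} ∈ 𝓝 z := fun z =>
    (isOpen_lt (by fun_prop) continuous_const).mem_nhds (by simpa using hδ0)
  have hQ : IsCompact {x : EuclideanSpace ℝ (Fin n) | ∀ i, |x i| ≤ 1} := by
    refine Metric.isCompact_of_isClosed_isBounded ?_ ?_
    · simp only [Set.ofPred_forall]
      exact isClosed_iInter fun i => isClosed_le (by fun_prop) continuous_const
    · refine (Metric.isBounded_closedBall (x := 0) (r := √(∑ _i : Fin n, 1))).subset fun x hx => ?_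
      rw [mem_closedBall_zero_iff, EuclideanSpace.norm_eq]
      refine Real.sqrt_le_sqrt (Finset.sum_le_sum fun i _ => ?_)
      have := hx i
      rw [Real.norm_eq_abs]
      nlinarith [abs_nonneg (x i)]
  obtain ⟨F, -, hF⟩ := hQ.elim_nhds_subcover _ fun z _ => hsum z
  have hnear : ∀ᶠ ψ in 𝓝 φ, ∀ z ∈ F, |ψ z - φ z| < δ := by
    rw [Filter.eventually_all_finset]
    intro z _
    have hc : Continuous fun ψ : EuclideanSpace ℝ (Fin n) → ℝ => |ψ z - φ z| := by fun_prop
    exact (isOpen_lt hc continuous_const).mem_nhds (by simpa using hδ0)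
  rw [eventually_nhdsWithin_iff]
  filter_upwards [hnear] with ψ hψF hψ
  have hclose : ∀ x : EuclideanSpace ℝ (Fin n), (∀ i, |x i| ≤ 1) → |ψ x - φ x| ≤ t - 1 := by
    intro x hx
    obtain ⟨z, hz, hxz⟩ := Set.mem_iUnion₂.1 (hF hx)
    have h1 := normalizedNorms_sub_le hφ x z
    have h2 := normalizedNorms_sub_le hψ x z
    have h3 := hψF z hz
    have h4 : ∑ i, |x i - z i| < δ := hxz
    rw [abs_le] at *
    rw [abs_lt] at h3
    constructor <;> linarith
  have key : ∀ {φ ψ : EuclideanSpace ℝ (Fin n) → ℝ}, φ ∈ normalizedNorms n →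
      ψ ∈ normalizedNorms n → (∀ x : EuclideanSpace ℝ (Fin n), (∀ i, |x i| ≤ 1) →
        |ψ x - φ x| ≤ t - 1) → ∀ x ∈ unitBody φ, t⁻¹ • x ∈ unitBody ψ := by
    intro φ ψ hφ hψ h x hx
    have h1 := (abs_le.1 (h x fun i => ((hφ.2.2 x).1 i).trans hx)).2
    have h2 : φ x ≤ 1 := hx
    change ψ (t⁻¹ • x) ≤ 1
    rw [hψ.2.1, norm_inv, Real.norm_of_nonneg (by linarith), inv_mul_le_iff₀ (by linarith)]
    linarith
  have hle := centroidRatio_le_of_subset hp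
    (isCompact_unitBody (normalizedSeminorm_pos hφ)) (isCompact_unitBody (normalizedSeminorm_pos hψ))
    (unitBody_mem_nhds _) (unitBody_mem_nhds _) (by linarith : 0 < t)
    (key hφ hψ hclose) (key hψ hφ fun x hx => by rw [abs_sub_comm]; exact hclose x hx)
  have hlt : (t ^ d) ^ C * y < (t ^ d) ^ C * centroidRatio p (unitBody ψ) := ht.trans_le hle
  exact lt_of_mul_lt_mul_left hlt (by positivity)

lemma unitBody_comp (L : Seminorm ℝ (EuclideanSpace ℝ (Fin n)))
    (T : EuclideanSpace ℝ (Fin n) ≃ₗ[ℝ] EuclideanSpace ℝ (Fin n)) :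
    unitBody (L.comp (T : _ →ₗ[ℝ] _)) = T ⁻¹' unitBody L := rfl

/-- The centroid ratio attains its minimum over all norms. -/
lemma exists_minimizer {p : ℝ} (hp : 1 < p) :
    ∃ L₀ : Seminorm ℝ (EuclideanSpace ℝ (Fin n)), (∀ x ≠ 0, 0 < L₀ x) ∧
      ∀ L : Seminorm ℝ (EuclideanSpace ℝ (Fin n)), (∀ x ≠ 0, 0 < L x) →
        centroidRatio p (unitBody L₀) ≤ centroidRatio p (unitBody L) := by
  have hmem : ∀ L : Seminorm ℝ (EuclideanSpace ℝ (Fin n)), (∀ x ≠ 0, 0 < L x) →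
      ∃ φ ∈ normalizedNorms n,
        centroidRatio p (unitBody φ) = centroidRatio p (unitBody L) := by
    intro L hL
    obtain ⟨T, hT⟩ := exists_auerbach L hL
    refine ⟨L.comp (T : EuclideanSpace ℝ (Fin n) →ₗ[ℝ] EuclideanSpace ℝ (Fin n)),
      ⟨map_add_le_add _, map_smul_eq_mul _, hT⟩, ?_⟩
    rw [unitBody_comp]
    exact centroidRatio_preimage hp T (isCompact_unitBody hL).measurableSet
  obtain ⟨φ₁, hφ₁, -⟩ := hmem (normSeminorm ℝ _) fun x hx => norm_pos_iff.2 hx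
  obtain ⟨φ, hφ, hmin⟩ := (lowerSemicontinuousOn_centroidRatio hp).exists_isMinOn
    ⟨φ₁, hφ₁⟩ isCompact_normalizedNorms
  refine ⟨normalizedSeminorm hφ, normalizedSeminorm_pos hφ, fun L hL => ?_⟩
  obtain ⟨ψ, hψ, he⟩ := hmem L hL
  rw [← he]
  exact hmin hψ

end AffineSobolev

namespace AffineSobolev

open scoped Topology

/-! ### Orthogonal splitting into a hyperplane and a line -/

section Splitting

variable {W E : Type*} [NormedAddCommGroup W] [InnerProductSpace ℝ W] [FiniteDimensional ℝ W]
  [MeasurableSpace W] [BorelSpace W]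
  [NormedAddCommGroup E] [InnerProductSpace ℝ E] [FiniteDimensional ℝ E]
  [MeasurableSpace E] [BorelSpace E]

variable (W E) in
/-- An orthogonal splitting of a Euclidean space into a hyperplane and a line. -/
structure Splitting where
  /-- The underlying linear equivalence. -/
  toEquiv : (W × ℝ) ≃L[ℝ] E
  inner_eq : ∀ x y : W × ℝ, inner ℝ (toEquiv x) (toEquiv y) = inner ℝ x.1 y.1 + x.2 * y.2
  measurePreserving : MeasurePreserving toEquiv (volume : Measure (W × ℝ)) (volume : Measure E)

/-- The splitting in the direction of a unit vector. -/
lemma exists_splitting (u : E) (hu : ‖u‖ = 1) :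
    ∃ Ψ : Splitting (ℝ ∙ u)ᗮ E, ∀ z, Ψ.toEquiv z = (z.1 : E) + z.2 • u := by
  set K := ℝ ∙ u
  let e1 : ℝ ≃ₗᵢ[ℝ] K := LinearIsometryEquiv.toSpanUnitSingleton u hu
  let e2 : E ≃ₗᵢ[ℝ] WithLp 2 (K × Kᗮ) := K.orthogonalDecomposition
  let Φ : (Kᗮ × ℝ) ≃ₗ[ℝ] E := (LinearEquiv.prodComm ℝ Kᗮ ℝ).trans
    ((LinearEquiv.prodCongr e1.toLinearEquiv (LinearEquiv.refl ℝ Kᗮ)).trans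
      ((WithLp.linearEquiv 2 ℝ (K × Kᗮ)).symm.trans e2.symm.toLinearEquiv))
  have hΦ : ∀ z, Φ z = (z.1 : E) + z.2 • u := by
    intro z
    change e2.symm (WithLp.toLp 2 (e1 z.2, z.1)) = _
    rw [LinearIsometryEquiv.symm_apply_eq]
    have h := e2.apply_symm_apply (WithLp.toLp 2 (e1 z.2, z.1))
    rw [← h]
    congr 1
    rw [Submodule.orthogonalDecomposition_symm_apply]
    have h3 : (e1 z.2 : E) = z.2 • u := rfl
    simp [h3, add_comm]
  refine ⟨⟨Φ.toContinuousLinearEquiv, fun x y => ?_, ?_⟩, hΦ⟩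
  · change inner ℝ (Φ x) (Φ y) = _
    rw [hΦ, hΦ, inner_add_left, inner_add_right, inner_add_right, inner_smul_right,
      inner_smul_left, inner_smul_left, inner_smul_right]
    have h1 : inner ℝ u (y.1 : E) = 0 :=
      (Submodule.mem_orthogonal_singleton_iff_inner_right.1 y.1.2)
    have h2 : inner ℝ (x.1 : E) u = 0 :=
      (Submodule.mem_orthogonal_singleton_iff_inner_left.1 x.1.2)
    rw [h1, h2, real_inner_self_eq_norm_sq, hu]
    simp
  · have m1 : MeasurePreserving (Prod.swap : Kᗮ × ℝ → ℝ × Kᗮ) volume volume :=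
      Measure.measurePreserving_swap
    have m2 : MeasurePreserving (Prod.map e1 id : ℝ × Kᗮ → K × Kᗮ) volume volume :=
      e1.measurePreserving.prod (MeasurePreserving.id _)
    have m3 : MeasurePreserving (WithLp.toLp 2 : K × Kᗮ → _) volume volume :=
      WithLp.volume_preserving_toLp _ _
    exact e2.symm.measurePreserving.comp (m3.comp (m2.comp m1))

end Splitting

/-! ### Chords of a convex body in terms of its support function -/

section Sections

variable {W E : Type*} [NormedAddCommGroup W] [InnerProductSpace ℝ W] [FiniteDimensional ℝ W]
  [MeasurableSpace W] [BorelSpace W]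
  [NormedAddCommGroup E] [InnerProductSpace ℝ E] [FiniteDimensional ℝ E]
  [MeasurableSpace E] [BorelSpace E]

/-- The convex body with support function `H`. -/
def supportBody (H : E → ℝ) : Set E := {x | ∀ y, inner ℝ x y ≤ H y}

lemma Splitting.volume_eq (Ψ : Splitting W E) {P : Set E} (hP : MeasurableSet P) :
    volume P = ∫⁻ x : W, volume {t : ℝ | Ψ.toEquiv (x, t) ∈ P} := by
  rw [← Ψ.measurePreserving.measure_preimage hP.nullMeasurableSet, Measure.volume_eq_prod,
    Measure.prod_apply (Ψ.measurePreserving.measurable hP)]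
  rfl

/-- The height over `x` of the body with support function `H`. -/
noncomputable def height (Ψ : Splitting W E) (H : Seminorm ℝ E) (x : W) : ℝ :=
  ⨅ y : W, (H (Ψ.toEquiv (y, 1)) - inner ℝ x y)

/-- The shadow of the body with support function `H` on the hyperplane. -/
def shadow (Ψ : Splitting W E) (H : Seminorm ℝ E) : Set W :=
  {x | ∀ y, inner ℝ x y ≤ H (Ψ.toEquiv (y, 0))}

variable (Ψ : Splitting W E) (H : Seminorm ℝ E)

lemma neg_mem_shadow {x : W} (hx : x ∈ shadow Ψ H) : -x ∈ shadow Ψ H := fun y => by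
  have := hx (-y)
  have h2 : Ψ.toEquiv (-y, 0) = -Ψ.toEquiv (y, 0) := by rw [← map_neg]; simp
  rw [h2, map_neg_eq_map] at this
  simpa using this

lemma seminorm_splitting_sub_le (y : W) :
    H (Ψ.toEquiv (y, 0)) - H (Ψ.toEquiv (0, 1)) ≤ H (Ψ.toEquiv (y, 1)) := by
  have h : Ψ.toEquiv (y, 0) = Ψ.toEquiv (y, 1) - Ψ.toEquiv (0, 1) := by rw [← map_sub]; simp
  rw [h]
  linarith [map_sub_le_add H (Ψ.toEquiv (y, 1)) (Ψ.toEquiv (0, 1))]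

lemma bddBelow_height {x : W} (hx : x ∈ shadow Ψ H) :
    BddBelow (Set.range fun y : W => H (Ψ.toEquiv (y, 1)) - inner ℝ x y) := by
  refine ⟨-H (Ψ.toEquiv (0, 1)), ?_⟩
  rintro _ ⟨y, rfl⟩
  have := hx y
  have := seminorm_splitting_sub_le Ψ H y
  change _ ≤ H (Ψ.toEquiv (y, 1)) - inner ℝ x y
  linarith

lemma height_le {x : W} (hx : x ∈ shadow Ψ H) (y : W) :
    height Ψ H x ≤ H (Ψ.toEquiv (y, 1)) - inner ℝ x y :=
  ciInf_le (bddBelow_height Ψ H hx) y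

/-- By homogeneity it is enough to test vectors whose last coordinate is 0, 1 or -1. These give
respectively the shadow, the upper bound and the lower bound for `t`; the lower one is expressed
through -x because `H` is even. -/
lemma mem_supportBody_iff {x : W} {t : ℝ} :
    Ψ.toEquiv (x, t) ∈ supportBody H ↔
      x ∈ shadow Ψ H ∧ t ∈ Set.Icc (-height Ψ H (-x)) (height Ψ H x) := by
  constructor
  · intro h
    have hx : x ∈ shadow Ψ H := fun y => by
      have := h (Ψ.toEquiv (y, 0))
      rw [Ψ.inner_eq] at this
      simpa using this
    refine ⟨hx, ?_, le_ciInf fun y => ?_⟩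
    · rw [neg_le]
      refine le_ciInf fun y => ?_
      have := h (Ψ.toEquiv (-y, -1))
      rw [Ψ.inner_eq, show Ψ.toEquiv (-y, -1) = -Ψ.toEquiv (y, 1) by rw [← map_neg]; simp,
        map_neg_eq_map] at this
      simp at this ⊢
      linarith
    · have := h (Ψ.toEquiv (y, 1))
      rw [Ψ.inner_eq] at this
      simp at this
      linarith
  · rintro ⟨hx, ht1, ht2⟩ z
    obtain ⟨⟨y, σ⟩, rfl⟩ := Ψ.toEquiv.surjective z
    rw [Ψ.inner_eq]
    rcases lt_trichotomy σ 0 with hσ | rfl | hσ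
    · have h1 := height_le Ψ H (neg_mem_shadow Ψ H hx) (σ⁻¹ • y)
      have h2 : Ψ.toEquiv (y, σ) = σ • Ψ.toEquiv (σ⁻¹ • y, 1) := by
        rw [← map_smul]; simp [smul_smul, hσ.ne]
      rw [h2, map_smul_eq_mul, Real.norm_eq_abs, abs_of_neg hσ]
      rw [inner_neg_left, inner_smul_right] at h1
      have h3 : -t ≤ H (Ψ.toEquiv (σ⁻¹ • y, 1)) + σ⁻¹ * inner ℝ x y := by linarith
      have h4 := mul_le_mul_of_nonneg_left h3 (neg_nonneg.2 hσ.le)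
      have h5 : σ * (σ⁻¹ * inner ℝ x y) = inner ℝ x y := mul_inv_cancel_left₀ hσ.ne _
      dsimp only
      nlinarith
    · simpa using hx y
    · have h1 := height_le Ψ H hx (σ⁻¹ • y)
      have h2 : Ψ.toEquiv (y, σ) = σ • Ψ.toEquiv (σ⁻¹ • y, 1) := by
        rw [← map_smul]; simp [smul_smul, hσ.ne']
      rw [h2, map_smul_eq_mul, Real.norm_eq_abs, abs_of_pos hσ]
      rw [inner_smul_right] at h1
      have h3 : t ≤ H (Ψ.toEquiv (σ⁻¹ • y, 1)) - σ⁻¹ * inner ℝ x y := by linarith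
      have h4 := mul_le_mul_of_nonneg_left h3 hσ.le
      have h5 : σ * (σ⁻¹ * inner ℝ x y) = inner ℝ x y := mul_inv_cancel_left₀ hσ.ne' _
      dsimp only
      nlinarith

lemma volume_section {x : W} (hx : x ∈ shadow Ψ H) :
    volume {t : ℝ | Ψ.toEquiv (x, t) ∈ supportBody H} =
      ENNReal.ofReal (height Ψ H x + height Ψ H (-x)) := by
  have : {t : ℝ | Ψ.toEquiv (x, t) ∈ supportBody H} =
      Set.Icc (-height Ψ H (-x)) (height Ψ H x) := by
    ext t
    simp [mem_supportBody_iff, hx]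
  rw [this, Real.volume_Icc, sub_neg_eq_add]

omit [FiniteDimensional ℝ E] [MeasurableSpace E] [BorelSpace E] in
lemma isClosed_supportBody (H : E → ℝ) : IsClosed (supportBody H) := by
  simp only [supportBody, Set.ofPred_forall]
  exact isClosed_iInter fun y => isClosed_le (by fun_prop) continuous_const

variable {Ψ H} {H' : Seminorm ℝ E}
  (h0 : ∀ y, H' (Ψ.toEquiv (y, 0)) = H (Ψ.toEquiv (y, 0)))
  (h1 : ∀ y₁ y₂ : W, 2 * H' (Ψ.toEquiv ((1 / 2 : ℝ) • (y₁ - y₂), 1)) ≤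
    H (Ψ.toEquiv (y₁, 1)) + H (Ψ.toEquiv (y₂, 1)))

include h0 in
lemma shadow_eq : shadow Ψ H' = shadow Ψ H := by
  simp only [shadow, h0]

include h0 h1 in
-- Take the infima over y₁ and y₂ separately and test the left side at (y₁-y₂)/2, where `h1`
-- applies. The hypotheses `h0` and `h1` are those that Steiner symmetrization provides for the
-- support functions of centroid bodies.
lemma height_symm_le {x : W} (hx : x ∈ shadow Ψ H) :
    2 * height Ψ H' x ≤ height Ψ H x + height Ψ H (-x) := by
  have hx' : x ∈ shadow Ψ H' := by rwa [shadow_eq h0]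
  rw [height, height, height, ← sub_le_iff_le_add]
  refine le_ciInf fun y₂ => ?_
  rw [sub_le_comm]
  refine le_ciInf fun y₁ => ?_
  have e1 := height_le Ψ H' hx' ((1 / 2 : ℝ) • (y₂ - y₁))
  have e2 := h1 y₂ y₁
  rw [inner_smul_right, inner_sub_right] at e1
  rw [inner_neg_left]
  change 2 * height Ψ H' x - _ ≤ _
  linarith

include h0 h1 in
-- The chord over x has length height(x) + height(-x), so the bound follows by adding
-- `height_symm_le` at x and at -x.
lemma volume_section_le (x : W) :
    volume {t : ℝ | Ψ.toEquiv (x, t) ∈ supportBody H'} ≤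
      volume {t : ℝ | Ψ.toEquiv (x, t) ∈ supportBody H} := by
  by_cases hx : x ∈ shadow Ψ H
  · rw [volume_section Ψ H hx, volume_section Ψ H' (by rwa [shadow_eq h0])]
    refine ENNReal.ofReal_le_ofReal ?_
    have e1 := height_symm_le h0 h1 hx
    have e2 := height_symm_le h0 h1 (neg_mem_shadow Ψ H hx)
    rw [neg_neg] at e2
    linarith
  · have : {t : ℝ | Ψ.toEquiv (x, t) ∈ supportBody H'} = ∅ := by
      ext t
      simp [mem_supportBody_iff, shadow_eq h0, hx]
    rw [this, measure_empty]
    exact zero_le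

/-- Since 2x is in the shadow, ⟨x,y⟩ is at most half of H(y,0). The function being minimized
therefore dominates H(y,0)/2 minus a constant and is coercive. -/
lemma exists_height_eq (hH : ∀ y ≠ 0, 0 < H y) {x : W} (hx : (2 : ℝ) • x ∈ shadow Ψ H) :
    ∃ y, height Ψ H x = H (Ψ.toEquiv (y, 1)) - inner ℝ x y := by
  obtain ⟨r, hr, hrH⟩ := exists_le_seminorm H hH
  have hnorm : ∀ y : W, ‖Ψ.toEquiv (y, 0)‖ = ‖y‖ := fun y => by
    have := Ψ.inner_eq (y, 0) (y, 0)
    simp only [real_inner_self_eq_norm_sq, mul_zero, add_zero] at this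
    exact (sq_eq_sq₀ (norm_nonneg _) (norm_nonneg _)).1 this
  have hcont : Continuous fun y : W => H (Ψ.toEquiv (y, 1)) - inner ℝ x y :=
    ((seminorm_continuous H).comp (Ψ.toEquiv.continuous.comp (by fun_prop))).sub (by fun_prop)
  have hcoer : Filter.Tendsto (fun y : W => H (Ψ.toEquiv (y, 1)) - inner ℝ x y)
      (Filter.cocompact W) Filter.atTop := by
    have ht : Filter.Tendsto (fun y : W => r / 2 * ‖y‖ + -H (Ψ.toEquiv (0, 1)))
        (Filter.cocompact W) Filter.atTop :=
      Filter.tendsto_atTop_add_const_right _ _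
        ((tendsto_norm_cocompact_atTop (E := W)).const_mul_atTop (by positivity))
    refine Filter.tendsto_atTop_mono (fun y => ?_) ht
    have e1 := hx y
    have e2 := seminorm_splitting_sub_le Ψ H y
    have e3 := hrH (Ψ.toEquiv (y, 0))
    rw [inner_smul_left] at e1
    simp only [conj_trivial] at e1
    rw [hnorm] at e3
    linarith
  obtain ⟨y, hy⟩ := hcont.exists_forall_le hcoer
  refine ⟨y, le_antisymm (ciInf_le ⟨_, Set.forall_mem_range.2 hy⟩ y) (le_ciInf hy)⟩

include h0 h1 in
/-- If symmetrizing the support function does not decrease the volume, then equality holds in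
the symmetrization for some pair of support functionals. -/
lemma exists_eq_of_volume_le (hH : ∀ y ≠ 0, 0 < H y) (hH' : ∀ y ≠ 0, 0 < H' y)
    (hfin : volume (supportBody H') ≠ ⊤)
    (hvol : volume (supportBody H) ≤ volume (supportBody H')) :
    ∃ y₁ y₂ : W, H (Ψ.toEquiv (y₁, 1)) + H (Ψ.toEquiv (y₂, 1)) ≤
      2 * H' (Ψ.toEquiv ((1 / 2 : ℝ) • (y₁ - y₂), 1)) := by
  have hm : ∀ L : Seminorm ℝ E, MeasurableSet (supportBody L) := fun L =>
    (isClosed_supportBody _).measurableSet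
  have hmeas : ∀ L : Seminorm ℝ E,
      Measurable fun x : W => volume {t : ℝ | Ψ.toEquiv (x, t) ∈ supportBody L} := fun L =>
    measurable_measure_prodMk_left (Ψ.measurePreserving.measurable (hm L))
  have hae : (fun x : W => volume {t : ℝ | Ψ.toEquiv (x, t) ∈ supportBody H'}) =ᵐ[volume]
      fun x => volume {t : ℝ | Ψ.toEquiv (x, t) ∈ supportBody H} := by
    refine ae_eq_of_ae_le_of_lintegral_le (.of_forall (volume_section_le h0 h1)) ?_
      (hmeas H).aemeasurable ?_
    · rwa [← Ψ.volume_eq (hm H')]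
    · rwa [← Ψ.volume_eq (hm H'), ← Ψ.volume_eq (hm H)]
  obtain ⟨r, hr, hrH⟩ := exists_le_seminorm H' hH'
  have hball : ∀ z : E, ‖z‖ ≤ r → z ∈ supportBody H' := fun z hz y =>
    (real_inner_le_norm z y).trans ((mul_le_mul_of_nonneg_right hz (norm_nonneg y)).trans (hrH y))
  -- Near the origin both x and 2x lie in the body: the first makes the chord lengths nonnegative,
  -- so that they can be read off from `ENNReal.ofReal`, and the second makes the infima attained.
  have hev : ∀ᶠ x : W in 𝓝 0, ‖Ψ.toEquiv ((2 : ℝ) • x, 0)‖ < r ∧ ‖Ψ.toEquiv (x, 0)‖ < r := by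
    have c1 : Continuous fun x : W => ‖Ψ.toEquiv ((2 : ℝ) • x, 0)‖ :=
      (Ψ.toEquiv.continuous.comp (by fun_prop)).norm
    have c2 : Continuous fun x : W => ‖Ψ.toEquiv (x, 0)‖ :=
      (Ψ.toEquiv.continuous.comp (by fun_prop)).norm
    have z : Ψ.toEquiv ((0 : W), (0 : ℝ)) = 0 := map_zero Ψ.toEquiv
    exact (c1.continuousAt.eventually_lt continuousAt_const (by simpa [z] using hr)).and
      (c2.continuousAt.eventually_lt continuousAt_const (by simpa [z] using hr))
  have hfreq := (frequently_ae_mem_iff.2 (Measure.measure_pos_of_mem_nhds volume hev).ne')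
  obtain ⟨x, ⟨hx1, hx2⟩, hx⟩ := (hfreq.and_eventually hae).exists
  have hs2 := (mem_supportBody_iff Ψ H').1 (hball _ hx1.le)
  have hs1 := (mem_supportBody_iff Ψ H').1 (hball _ hx2.le)
  have hsh2 : (2 : ℝ) • x ∈ shadow Ψ H := by rw [← shadow_eq h0]; exact hs2.1
  have hsh1 : x ∈ shadow Ψ H := by rw [← shadow_eq h0]; exact hs1.1
  have e1 := height_symm_le h0 h1 hsh1
  have e2 := height_symm_le h0 h1 (neg_mem_shadow Ψ H hsh1)
  rw [neg_neg] at e2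
  dsimp only at hx
  rw [volume_section Ψ H' hs1.1, volume_section Ψ H hsh1] at hx
  have hp1 := hs1.2.1
  have hp2 := hs1.2.2
  rw [ENNReal.ofReal_eq_ofReal_iff (by linarith) (by linarith)] at hx
  obtain ⟨y₁, hy₁⟩ := exists_height_eq hH hsh2
  obtain ⟨y₂, hy₂⟩ := exists_height_eq (x := -x) (Ψ := Ψ) hH
    (by simpa using neg_mem_shadow Ψ H hsh2)
  refine ⟨y₁, y₂, ?_⟩
  have e3 := height_le Ψ H' hs1.1 ((1 / 2 : ℝ) • (y₁ - y₂))
  rw [inner_smul_right, inner_sub_right] at e3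
  rw [inner_neg_left] at hy₂
  linarith

end Sections

end AffineSobolev

namespace AffineSobolev

open scoped Topology

/-! ### Steiner symmetrization and its effect on centroid bodies -/

section Steiner

variable {W E : Type*} [NormedAddCommGroup W] [InnerProductSpace ℝ W] [FiniteDimensional ℝ W]
  [MeasurableSpace W] [BorelSpace W]
  [NormedAddCommGroup E] [InnerProductSpace ℝ E] [FiniteDimensional ℝ E]
  [MeasurableSpace E] [BorelSpace E]

/-- The reflection in the hyperplane of a splitting. -/
def Splitting.refl (Ψ : Splitting W E) (z : E) : E :=
  Ψ.toEquiv ((Ψ.toEquiv.symm z).1, -(Ψ.toEquiv.symm z).2)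

/-- The shear along the line of a splitting with profile `m`. -/
def Splitting.shear (Ψ : Splitting W E) (m : W → ℝ) (z : E) : E :=
  Ψ.toEquiv ((Ψ.toEquiv.symm z).1, (Ψ.toEquiv.symm z).2 + m (Ψ.toEquiv.symm z).1)

variable (Ψ : Splitting W E)

lemma Splitting.refl_apply (x : W) (s : ℝ) : Ψ.refl (Ψ.toEquiv (x, s)) = Ψ.toEquiv (x, -s) := by
  simp [Splitting.refl]

lemma Splitting.shear_apply (m : W → ℝ) (x : W) (s : ℝ) :
    Ψ.shear m (Ψ.toEquiv (x, s)) = Ψ.toEquiv (x, s + m x) := by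
  simp [Splitting.shear]

lemma Splitting.forall_iff {P : E → Prop} : (∀ z, P z) ↔ ∀ x s, P (Ψ.toEquiv (x, s)) := by
  rw [Ψ.toEquiv.surjective.forall, Prod.forall]

lemma Splitting.refl_refl (z : E) : Ψ.refl (Ψ.refl z) = z := by
  revert z; rw [Ψ.forall_iff]; simp [Ψ.refl_apply]

lemma Splitting.continuous_refl : Continuous Ψ.refl := by
  unfold Splitting.refl
  exact Ψ.toEquiv.continuous.comp (by fun_prop)

/-- A splitting as a measurable equivalence. -/
def Splitting.toMeasurableEquiv : (W × ℝ) ≃ᵐ E := Ψ.toEquiv.toHomeomorph.toMeasurableEquiv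

lemma Splitting.measurePreserving_symm :
    MeasurePreserving Ψ.toEquiv.symm (volume : Measure E) (volume : Measure (W × ℝ)) :=
  MeasurePreserving.symm Ψ.toMeasurableEquiv Ψ.measurePreserving

/-- The reflection as a measurable equivalence. -/
def Splitting.reflEquiv : E ≃ᵐ E where
  toFun := Ψ.refl
  invFun := Ψ.refl
  left_inv := Ψ.refl_refl
  right_inv := Ψ.refl_refl
  measurable_toFun := Ψ.continuous_refl.measurable
  measurable_invFun := Ψ.continuous_refl.measurable

lemma Splitting.measurePreserving_refl : MeasurePreserving Ψ.refl := by
  have h : MeasurePreserving (Prod.map id (fun s : ℝ => -s) : W × ℝ → W × ℝ) volume volume :=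
    (MeasurePreserving.id _).prod (Measure.measurePreserving_neg _)
  exact Ψ.measurePreserving.comp (h.comp Ψ.measurePreserving_symm)

lemma Splitting.measurable_shear {m : W → ℝ} (hm : Measurable m) : Measurable (Ψ.shear m) := by
  have h : Measurable Ψ.toEquiv.symm := Ψ.toEquiv.symm.continuous.measurable
  exact Ψ.toEquiv.continuous.measurable.comp
    (h.fst.prodMk (h.snd.add (hm.comp h.fst)))

lemma Splitting.shear_neg_shear (m : W → ℝ) (z : E) :
    Ψ.shear (fun x => -m x) (Ψ.shear m z) = z := by
  revert z; rw [Ψ.forall_iff]; simp [Ψ.shear_apply]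

/-- The shear as a measurable equivalence. -/
def Splitting.shearEquiv {m : W → ℝ} (hm : Measurable m) : E ≃ᵐ E where
  toFun := Ψ.shear m
  invFun := Ψ.shear fun x => -m x
  left_inv := Ψ.shear_neg_shear m
  right_inv := fun z => by simpa using Ψ.shear_neg_shear (fun x => -m x) z
  measurable_toFun := Ψ.measurable_shear hm
  measurable_invFun := Ψ.measurable_shear hm.neg

lemma Splitting.measurePreserving_shear {m : W → ℝ} (hm : Measurable m) :
    MeasurePreserving (Ψ.shear m) := by
  have h : MeasurePreserving (fun z : W × ℝ => (id z.1, z.2 + m z.1)) volume volume := by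
    refine (MeasurePreserving.id volume).skew_product (g := fun x s => s + m x) ?_ ?_
    · exact measurable_snd.add (hm.comp measurable_fst)
    · exact .of_forall fun x => map_add_right_eq_self volume (m x)
  exact Ψ.measurePreserving.comp (h.comp Ψ.measurePreserving_symm)

/-- The top of a set over a point of the hyperplane. -/
noncomputable def topHeight (A : Set E) (x : W) : ℝ := sSup {s : ℝ | Ψ.toEquiv (x, s) ∈ A}

/-- The height of the midpoint of the chord of a symmetric convex body. -/
noncomputable def midHeight (A : Set E) (x : W) : ℝ := (topHeight Ψ A x - topHeight Ψ A (-x)) / 2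

/-- The Steiner symmetral of a symmetric convex body. -/
def steiner (A : Set E) : Set E := Ψ.shear (midHeight Ψ A) ⁻¹' A

variable {A : Set E}

lemma isCompact_section (hA : IsCompact A) (x : W) : IsCompact {s : ℝ | Ψ.toEquiv (x, s) ∈ A} := by
  have h1 : IsCompact (Ψ.toEquiv ⁻¹' A) := Ψ.toEquiv.toHomeomorph.isCompact_preimage.2 hA
  have h2 : IsClosed {s : ℝ | Ψ.toEquiv (x, s) ∈ A} :=
    hA.isClosed.preimage (Ψ.toEquiv.continuous.comp (by fun_prop))
  exact (h1.image continuous_snd).of_isClosed_subset h2 fun s hs => ⟨(x, s), hs, rfl⟩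

lemma measurable_topHeight (hA : IsCompact A) : Measurable (topHeight Ψ A) := by
  have h1 : IsCompact (Ψ.toEquiv ⁻¹' A) := Ψ.toEquiv.toHomeomorph.isCompact_preimage.2 hA
  refine measurable_of_Ici fun c => ?_
  have hD : MeasurableSet (Prod.fst '' (Ψ.toEquiv ⁻¹' A)) :=
    (h1.image continuous_fst).measurableSet
  have hDc : MeasurableSet (Prod.fst '' (Ψ.toEquiv ⁻¹' A ∩ {z | c ≤ z.2})) :=
    ((h1.inter_right (isClosed_le continuous_const continuous_snd)).image
      continuous_fst).measurableSet
  -- Superlevel sets are projections of compact sets, up to the points with empty fibre. There `sSup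
  -- ∅ = 0`, which accounts for the second piece.
  have heq : topHeight Ψ A ⁻¹' Set.Ici c =
      Prod.fst '' (Ψ.toEquiv ⁻¹' A ∩ {z | c ≤ z.2}) ∪
        ((Prod.fst '' (Ψ.toEquiv ⁻¹' A))ᶜ ∩ {_x | c ≤ 0}) := by
    ext x
    simp only [Set.mem_preimage, Set.mem_Ici, Set.mem_union, Set.mem_image, Set.mem_inter_iff,
      Set.mem_compl_iff, Set.mem_ofPred_eq, Prod.exists, exists_and_right, exists_eq_right]
    rcases Set.eq_empty_or_nonempty {s : ℝ | Ψ.toEquiv (x, s) ∈ A} with he | hne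
    · have h2 : ¬ ∃ s, Ψ.toEquiv (x, s) ∈ A := fun ⟨s, hs⟩ =>
        (Set.eq_empty_iff_forall_notMem.1 he s) hs
      have h3 : ¬ ∃ s, Ψ.toEquiv (x, s) ∈ A ∧ c ≤ s := fun ⟨s, hs⟩ => h2 ⟨s, hs.1⟩
      simp [topHeight, he, h2, h3]
    · have h2 : ∃ s, Ψ.toEquiv (x, s) ∈ A := hne
      have h3 := (isCompact_section Ψ hA x).sSup_mem hne
      simp only [h2, not_true, false_and, or_false]
      refine ⟨fun h => ⟨_, h3, h⟩, fun ⟨s, hs, hcs⟩ => hcs.trans ?_⟩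
      exact le_csSup (isCompact_section Ψ hA x).bddAbove hs
  rw [heq]
  exact hDc.union (hD.compl.inter (MeasurableSet.const _))

lemma measurable_midHeight (hA : IsCompact A) : Measurable (midHeight Ψ A) :=
  ((measurable_topHeight Ψ hA).sub ((measurable_topHeight Ψ hA).comp measurable_neg)).div_const 2

variable (hA : IsCompact A) (hconv : Convex ℝ A) (hsymm : ∀ z ∈ A, -z ∈ A)

include hA hsymm in
-- By central symmetry the bottom of the chord over x is minus the top of the chord over -x.
lemma mem_Icc_of_mem {x : W} {s : ℝ} (h : Ψ.toEquiv (x, s) ∈ A) :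
    s ∈ Set.Icc (-topHeight Ψ A (-x)) (topHeight Ψ A x) := by
  refine ⟨?_, le_csSup (isCompact_section Ψ hA x).bddAbove h⟩
  rw [neg_le]
  refine le_csSup (isCompact_section Ψ hA (-x)).bddAbove ?_
  have := hsymm _ h
  rwa [← map_neg, Prod.neg_mk] at this

include hA hconv hsymm in
lemma mem_of_mem_Icc {x : W} {s s' : ℝ} (h : Ψ.toEquiv (x, s) ∈ A)
    (h' : s' ∈ Set.Icc (-topHeight Ψ A (-x)) (topHeight Ψ A x)) : Ψ.toEquiv (x, s') ∈ A := by
  have h1 : Ψ.toEquiv (x, topHeight Ψ A x) ∈ A := (isCompact_section Ψ hA x).sSup_mem ⟨s, h⟩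
  have h2 : Ψ.toEquiv (-x, topHeight Ψ A (-x)) ∈ A := by
    refine (isCompact_section Ψ hA (-x)).sSup_mem ⟨-s, ?_⟩
    have := hsymm _ h
    rwa [← map_neg, Prod.neg_mk] at this
  have h3 := hsymm _ h2
  rw [← map_neg, Prod.neg_mk, neg_neg] at h3
  have hc : Convex ℝ {s : ℝ | Ψ.toEquiv (x, s) ∈ A} := by
    intro a ha b hb α β hα hβ hαβ
    have := hconv ha hb hα hβ hαβ
    rw [← map_smul, ← map_smul, ← map_add, Prod.smul_mk, Prod.smul_mk, Prod.mk_add_mk,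
      ← add_smul, hαβ, one_smul] at this
    exact this
  exact hc.ordConnected.out h3 h1 h'

lemma mem_steiner {x : W} {s : ℝ} :
    Ψ.toEquiv (x, s) ∈ steiner Ψ A ↔ Ψ.toEquiv (x, s + midHeight Ψ A x) ∈ A := by
  rw [steiner, Set.mem_preimage, Ψ.shear_apply]

include hA hconv hsymm in
lemma refl_mem_steiner {z : E} (h : z ∈ steiner Ψ A) : Ψ.refl z ∈ steiner Ψ A := by
  revert z
  rw [Ψ.forall_iff]
  intro x s h
  rw [Ψ.refl_apply, mem_steiner]
  rw [mem_steiner] at h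
  refine mem_of_mem_Icc Ψ hA hconv hsymm h ?_
  have := mem_Icc_of_mem Ψ hA hsymm h
  rw [Set.mem_Icc, midHeight] at *
  constructor <;> linarith [this.1, this.2]

include hA hconv hsymm in
-- Half-differences of two points of a chord fill the centred chord of the same length. This
-- description does not mention the merely measurable function `midHeight`, so compactness and
-- convexity pass to the symmetral.
lemma mem_steiner_iff {x : W} {s : ℝ} : Ψ.toEquiv (x, s) ∈ steiner Ψ A ↔
    ∃ a b, Ψ.toEquiv (x, a) ∈ A ∧ Ψ.toEquiv (x, b) ∈ A ∧ s = (a - b) / 2 := by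
  constructor
  · intro h
    have h2 := refl_mem_steiner Ψ hA hconv hsymm h
    rw [Ψ.refl_apply, mem_steiner] at h2
    rw [mem_steiner] at h
    exact ⟨_, _, h, h2, by ring⟩
  · rintro ⟨a, b, ha, hb, rfl⟩
    rw [mem_steiner]
    refine mem_of_mem_Icc Ψ hA hconv hsymm ha ?_
    have h1 := mem_Icc_of_mem Ψ hA hsymm ha
    have h2 := mem_Icc_of_mem Ψ hA hsymm hb
    rw [Set.mem_Icc, midHeight] at *
    constructor <;> linarith [h1.1, h1.2, h2.1, h2.2]

include hA hconv hsymm in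
lemma steiner_eq_image : steiner Ψ A =
    (fun z : E × E => Ψ.toEquiv ((Ψ.toEquiv.symm z.1).1,
      ((Ψ.toEquiv.symm z.1).2 - (Ψ.toEquiv.symm z.2).2) / 2)) ''
      ((A ×ˢ A) ∩ {z | (Ψ.toEquiv.symm z.1).1 = (Ψ.toEquiv.symm z.2).1}) := by
  refine Set.ext ?_
  rw [Ψ.forall_iff]
  intro x s
  rw [mem_steiner_iff Ψ hA hconv hsymm]
  constructor
  · rintro ⟨a, b, ha, hb, rfl⟩
    exact ⟨(Ψ.toEquiv (x, a), Ψ.toEquiv (x, b)), ⟨⟨ha, hb⟩, by simp⟩, by simp⟩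
  · rintro ⟨⟨z, w⟩, ⟨⟨hz, hw⟩, hzw⟩, h⟩
    obtain ⟨⟨x1, a⟩, rfl⟩ := Ψ.toEquiv.surjective z
    obtain ⟨⟨x2, b⟩, rfl⟩ := Ψ.toEquiv.surjective w
    simp only [ContinuousLinearEquiv.symm_apply_apply, Set.mem_ofPred_eq,
      EmbeddingLike.apply_eq_iff_eq, Prod.mk.injEq] at hzw h
    obtain ⟨rfl, rfl⟩ := h
    subst hzw
    exact ⟨a, b, hz, hw, rfl⟩

include hA hconv hsymm in
lemma isCompact_steiner : IsCompact (steiner Ψ A) := by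
  rw [steiner_eq_image Ψ hA hconv hsymm]
  refine ((hA.prod hA).inter_right (isClosed_eq ?_ ?_)).image ?_
  · fun_prop
  · fun_prop
  · exact Ψ.toEquiv.continuous.comp (by fun_prop)

include hA hconv hsymm in
lemma convex_steiner : Convex ℝ (steiner Ψ A) := by
  rw [convex_iff_add_mem, Ψ.forall_iff]
  intro x s h
  rw [Ψ.forall_iff]
  intro x' s' h' α β hα hβ hαβ
  rw [mem_steiner_iff Ψ hA hconv hsymm] at h h'
  obtain ⟨a, b, ha, hb, rfl⟩ := h
  obtain ⟨a', b', ha', hb', rfl⟩ := h'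
  rw [← map_smul, ← map_smul, ← map_add, Prod.smul_mk, Prod.smul_mk, Prod.mk_add_mk,
    mem_steiner_iff Ψ hA hconv hsymm]
  have h1 := hconv ha ha' hα hβ hαβ
  have h2 := hconv hb hb' hα hβ hαβ
  rw [← map_smul, ← map_smul, ← map_add, Prod.smul_mk, Prod.smul_mk, Prod.mk_add_mk] at h1 h2
  refine ⟨_, _, h1, h2, ?_⟩
  simp only [smul_eq_mul]
  ring

include hA hconv hsymm in
lemma neg_mem_steiner {z : E} (h : z ∈ steiner Ψ A) : -z ∈ steiner Ψ A := by
  revert z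
  rw [Ψ.forall_iff]
  intro x s h
  rw [mem_steiner_iff Ψ hA hconv hsymm] at h
  obtain ⟨a, b, ha, hb, rfl⟩ := h
  have h1 := hsymm _ ha
  have h2 := hsymm _ hb
  rw [← map_neg, Prod.neg_mk] at h1 h2 ⊢
  rw [mem_steiner_iff Ψ hA hconv hsymm]
  exact ⟨_, _, h1, h2, by ring⟩

include hA hconv hsymm in
lemma steiner_mem_nhds (h0 : A ∈ 𝓝 0) : steiner Ψ A ∈ 𝓝 0 := by
  have hz : Ψ.refl 0 = 0 := by simp [Splitting.refl]
  have h1 : Ψ.refl ⁻¹' A ∈ 𝓝 0 := Ψ.continuous_refl.continuousAt.preimage_mem_nhds (by rwa [hz])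
  refine Filter.mem_of_superset (Filter.inter_mem h0 h1) ?_
  change ∀ z, _
  rw [Ψ.forall_iff]
  rintro x s ⟨hz1, hz2⟩
  rw [Set.mem_preimage, Ψ.refl_apply] at hz2
  rw [mem_steiner_iff Ψ hA hconv hsymm]
  exact ⟨s, -s, hz1, hz2, by ring⟩

include hA in
lemma volume_steiner : volume (steiner Ψ A) = volume A :=
  (Ψ.measurePreserving_shear (measurable_midHeight Ψ hA)).measure_preimage
    hA.measurableSet.nullMeasurableSet

include hA in
lemma setIntegral_steiner (G : E → ℝ) :
    ∫ z in steiner Ψ A, G (Ψ.shear (midHeight Ψ A) z) = ∫ z in A, G z :=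
  (Ψ.measurePreserving_shear (measurable_midHeight Ψ hA)).setIntegral_preimage_emb
    (Ψ.shearEquiv (measurable_midHeight Ψ hA)).measurableEmbedding G A

include hA hconv hsymm in
lemma refl_preimage_steiner : Ψ.refl ⁻¹' steiner Ψ A = steiner Ψ A := by
  ext z
  refine ⟨fun h => ?_, fun h => refl_mem_steiner Ψ hA hconv hsymm h⟩
  have := refl_mem_steiner Ψ hA hconv hsymm (z := Ψ.refl z) h
  rwa [Ψ.refl_refl] at this

include hA hconv hsymm in
lemma setIntegral_steiner_refl (G : E → ℝ) :
    ∫ z in steiner Ψ A, G (Ψ.refl z) = ∫ z in steiner Ψ A, G z := by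
  have := Ψ.measurePreserving_refl.setIntegral_preimage_emb Ψ.reflEquiv.measurableEmbedding G
    (steiner Ψ A)
  rwa [refl_preimage_steiner Ψ hA hconv hsymm] at this

include hA in
lemma memLp_shear (q : ENNReal) (y : E) :
    MemLp (fun z => inner ℝ (Ψ.shear (midHeight Ψ A) z) y) q (volume.restrict (steiner Ψ A)) := by
  have h := (Ψ.measurePreserving_shear (measurable_midHeight Ψ hA)).restrict_preimage
    hA.measurableSet
  exact (memLp_inner_of_isCompact hA q y).comp_measurePreserving h

include hA hconv hsymm in
lemma measurePreserving_refl_steiner :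
    MeasurePreserving Ψ.refl (volume.restrict (steiner Ψ A)) (volume.restrict (steiner Ψ A)) := by
  have := Ψ.measurePreserving_refl.restrict_preimage
    (isCompact_steiner Ψ hA hconv hsymm).measurableSet
  rwa [refl_preimage_steiner Ψ hA hconv hsymm] at this

include hA hconv hsymm in
lemma memLp_shear_refl (q : ENNReal) (y : E) :
    MemLp (fun z => -inner ℝ (Ψ.shear (midHeight Ψ A) (Ψ.refl z)) y) q
      (volume.restrict (steiner Ψ A)) :=
  ((memLp_shear Ψ hA q y).comp_measurePreserving
    (measurePreserving_refl_steiner Ψ hA hconv hsymm)).neg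

/-- The two points of `A` that correspond to z and to its reflection carry the same shift m(x),
which cancels in the difference. -/
lemma inner_shear_add (m : W → ℝ) (y₁ y₂ : W) (z : E) :
    inner ℝ (Ψ.shear m z) (Ψ.toEquiv (y₁, 1)) + -inner ℝ (Ψ.shear m (Ψ.refl z)) (Ψ.toEquiv (y₂, 1)) =
      2 * inner ℝ z (Ψ.toEquiv ((1 / 2 : ℝ) • (y₁ - y₂), 1)) := by
  revert z
  rw [Ψ.forall_iff]
  intro x s
  rw [Ψ.refl_apply, Ψ.shear_apply, Ψ.shear_apply, Ψ.inner_eq, Ψ.inner_eq, Ψ.inner_eq]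
  simp only [inner_smul_right, inner_sub_right]
  ring

include hA in
lemma moment_steiner_zero (p : ℝ) (y : W) :
    moment p (steiner Ψ A) (Ψ.toEquiv (y, 0)) = moment p A (Ψ.toEquiv (y, 0)) := by
  rw [moment, moment, ← setIntegral_steiner Ψ hA]
  congr 1
  ext z
  revert z
  rw [Ψ.forall_iff]
  intro x s
  rw [Ψ.shear_apply, Ψ.inner_eq, Ψ.inner_eq]
  simp

include hA hconv hsymm in
lemma integral_shear_refl (p : ℝ) (y : E) :
    ∫ z in steiner Ψ A, |-inner ℝ (Ψ.shear (midHeight Ψ A) (Ψ.refl z)) y| ^ p = moment p A y := by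
  simp only [abs_neg]
  rw [setIntegral_steiner_refl Ψ hA hconv hsymm
    (fun z => |inner ℝ (Ψ.shear (midHeight Ψ A) z) y| ^ p),
    setIntegral_steiner Ψ hA (fun z => |inner ℝ z y| ^ p)]
  rfl

include hA hconv hsymm in
lemma integral_shear_add {p : ℝ} (hp : 1 < p) (y₁ y₂ : W) :
    ∫ z in steiner Ψ A, |inner ℝ (Ψ.shear (midHeight Ψ A) z) (Ψ.toEquiv (y₁, 1)) +
      -inner ℝ (Ψ.shear (midHeight Ψ A) (Ψ.refl z)) (Ψ.toEquiv (y₂, 1))| ^ p =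
    (2 * momentSeminorm hp (isCompact_steiner Ψ hA hconv hsymm)
      (Ψ.toEquiv ((1 / 2 : ℝ) • (y₁ - y₂), 1))) ^ p := by
  rw [Real.mul_rpow (by norm_num) (apply_nonneg _ _), ← moment_eq_rpow, moment,
    ← integral_const_mul]
  congr 1
  ext z
  rw [inner_shear_add, abs_mul, Real.mul_rpow (abs_nonneg _) (abs_nonneg _), abs_two]

include hconv hsymm in
-- Minkowski's inequality on the symmetral for the two summands of `inner_shear_add`. Their norms
-- are moments of `A`, because shear and reflection preserve volume.
lemma moment_steiner_le {p : ℝ} (hp : 1 < p) (y₁ y₂ : W) :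
    2 * momentSeminorm hp (isCompact_steiner Ψ hA hconv hsymm)
        (Ψ.toEquiv ((1 / 2 : ℝ) • (y₁ - y₂), 1)) ≤
      momentSeminorm hp hA (Ψ.toEquiv (y₁, 1)) + momentSeminorm hp hA (Ψ.toEquiv (y₂, 1)) := by
  have h := integral_abs_add_rpow_le hp (memLp_shear Ψ hA _ (Ψ.toEquiv (y₁, 1)))
    (memLp_shear_refl Ψ hA hconv hsymm _ (Ψ.toEquiv (y₂, 1)))
  rw [integral_shear_add Ψ hA hconv hsymm hp, integral_shear_refl Ψ hA hconv hsymm,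
    setIntegral_steiner Ψ hA (fun z => |inner ℝ z (Ψ.toEquiv (y₁, 1))| ^ p), one_div p,
    Real.rpow_rpow_inv (by have := apply_nonneg (momentSeminorm hp (isCompact_steiner Ψ hA hconv hsymm)) (Ψ.toEquiv ((1 / 2 : ℝ) • (y₁ - y₂), 1)); positivity) (by linarith)] at h
  simpa [momentSeminorm_apply, moment] using h

/-- Equality in the symmetrization forces the midpoints of the chords to lie on a hyperplane. -/
lemma exists_midHeight_eq_inner {p : ℝ} (hp : 1 < p) (h0 : A ∈ 𝓝 0) (y₁ y₂ : W)
    (h : momentSeminorm hp hA (Ψ.toEquiv (y₁, 1)) + momentSeminorm hp hA (Ψ.toEquiv (y₂, 1)) ≤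
      2 * momentSeminorm hp (isCompact_steiner Ψ hA hconv hsymm)
        (Ψ.toEquiv ((1 / 2 : ℝ) • (y₁ - y₂), 1))) :
    ∃ w : W, ∀ᵐ z ∂volume.restrict (steiner Ψ A),
      midHeight Ψ A (Ψ.toEquiv.symm z).1 = inner ℝ (Ψ.toEquiv.symm z).1 w := by
  have hne : ∀ y : W, Ψ.toEquiv (y, (1 : ℝ)) ≠ 0 := fun y hy => by
    rw [map_eq_zero_iff _ Ψ.toEquiv.injective] at hy
    simpa using congrArg Prod.snd hy
  have ha := moment_rpow_inv_pos hp hA h0 _ (hne y₁)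
  have hb := moment_rpow_inv_pos hp hA h0 _ (hne y₂)
  set a := momentSeminorm hp hA (Ψ.toEquiv (y₁, 1))
  set b := momentSeminorm hp hA (Ψ.toEquiv (y₂, 1))
  have hae := ae_eq_of_integral_abs_add_rpow_ge hp (memLp_shear Ψ hA _ (Ψ.toEquiv (y₁, 1)))
    (memLp_shear_refl Ψ hA hconv hsymm _ (Ψ.toEquiv (y₂, 1))) ha hb
    (by rw [setIntegral_steiner Ψ hA (fun z => |inner ℝ z (Ψ.toEquiv (y₁, 1))| ^ p)]
        exact moment_eq_rpow hp hA _)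
    (by rw [integral_shear_refl Ψ hA hconv hsymm]; exact moment_eq_rpow hp hA _)
    (by rw [integral_shear_add Ψ hA hconv hsymm hp]
        exact Real.rpow_le_rpow (by positivity) h (by linarith))
  -- Subtracting the identity at the reflected point isolates b s = a s. Were a ≠ b, the symmetral
  -- would be flat up to a null set.
  have hae' := (measurePreserving_refl_steiner Ψ hA hconv hsymm).quasiMeasurePreserving.ae hae
  have hboth : ∀ᵐ z ∂volume.restrict (steiner Ψ A),
      b * (inner ℝ (Ψ.toEquiv.symm z).1 y₁ + (Ψ.toEquiv.symm z).2 +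
        midHeight Ψ A (Ψ.toEquiv.symm z).1) =
        a * (-inner ℝ (Ψ.toEquiv.symm z).1 y₂ + (Ψ.toEquiv.symm z).2 -
          midHeight Ψ A (Ψ.toEquiv.symm z).1) ∧
      b * (Ψ.toEquiv.symm z).2 = a * (Ψ.toEquiv.symm z).2 := by
    filter_upwards [hae, hae']
    rw [Ψ.forall_iff]
    intro x s e1 e2
    simp only [Ψ.refl_apply, Ψ.shear_apply, Ψ.inner_eq, neg_neg,
      ContinuousLinearEquiv.symm_apply_apply] at *
    constructor <;> linarith
  have hab : b = a := by
    by_contra hba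
    have hz : ∀ᵐ z ∂volume.restrict (steiner Ψ A), (Ψ.toEquiv.symm z).2 = 0 := by
      filter_upwards [hboth] with z hz
      have : (b - a) * (Ψ.toEquiv.symm z).2 = 0 := by linarith [hz.2]
      exact (mul_eq_zero.1 this).resolve_left (sub_ne_zero.2 hba)
    have hmom : moment p (steiner Ψ A) (Ψ.toEquiv (0, 1)) = 0 := by
      rw [moment, integral_eq_zero_of_ae]
      filter_upwards [hz]
      rw [Ψ.forall_iff]
      intro x s hs
      rw [ContinuousLinearEquiv.symm_apply_apply] at hs
      rw [Ψ.inner_eq]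
      simp only [] at hs
      simp [hs, Real.zero_rpow (by linarith : p ≠ 0)]
    exact (moment_pos hp (isCompact_steiner Ψ hA hconv hsymm)
      (steiner_mem_nhds Ψ hA hconv hsymm h0) (hne 0)).ne' hmom
  -- With a = b the identity reads ⟨x,y₁⟩ + m = -⟨x,y₂⟩ - m, which determines the linear form.
  refine ⟨-(1 / 2 : ℝ) • (y₁ + y₂), ?_⟩
  filter_upwards [hboth] with z hz
  have h1 := hz.1
  rw [hab] at h1
  have h2 := mul_left_cancel₀ ha.ne' h1
  rw [inner_smul_right, inner_add_right]
  linarith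

/-- In isotropic position, midpoints of chords lying on a hyperplane lie on the
orthogonal hyperplane. -/
lemma midHeight_ae_eq_zero (w : W) (hconv : Convex ℝ A) (hsymm : ∀ z ∈ A, -z ∈ A) (hA : IsCompact A)
    (hw : ∀ᵐ z ∂volume.restrict (steiner Ψ A),
      midHeight Ψ A (Ψ.toEquiv.symm z).1 = inner ℝ (Ψ.toEquiv.symm z).1 w)
    (hiso : ∀ y z : E, inner ℝ y z = (0 : ℝ) → ∫ x in A, inner ℝ x y * inner ℝ x z = (0 : ℝ)) :
    ∀ᵐ z ∂volume.restrict A, midHeight Ψ A (Ψ.toEquiv.symm z).1 = 0 := by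
  have hc := isCompact_steiner Ψ hA hconv hsymm
  have int : ∀ G : W × ℝ → ℝ, Continuous G →
      IntegrableOn (fun z => G (Ψ.toEquiv.symm z)) (steiner Ψ A) := fun G hG =>
    (hG.comp Ψ.toEquiv.symm.continuous).continuousOn.integrableOn_compact hc
  -- On the symmetral this orthogonality becomes ∫ ⟨x,w⟩ s + ∫ ⟨x,w⟩² = 0. The cross term is odd
  -- under reflection, so ⟨x,w⟩ vanishes almost everywhere.
  have e1 := hiso (Ψ.toEquiv (w, 0)) (Ψ.toEquiv (0, 1)) (by rw [Ψ.inner_eq]; simp)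
  rw [← setIntegral_steiner Ψ hA] at e1
  have e2 : ∫ z in steiner Ψ A, (inner ℝ (Ψ.toEquiv.symm z).1 w * (Ψ.toEquiv.symm z).2 +
      (inner ℝ (Ψ.toEquiv.symm z).1 w) ^ 2 : ℝ) = 0 := by
    rw [← e1]
    refine integral_congr_ae ?_
    filter_upwards [hw]
    rw [Ψ.forall_iff]
    intro x s hx
    rw [ContinuousLinearEquiv.symm_apply_apply] at *
    rw [Ψ.shear_apply, Ψ.inner_eq, Ψ.inner_eq]
    simp only [] at hx
    simp [hx]
    ring
  rw [integral_add (int (fun z => inner ℝ z.1 w * z.2) (by fun_prop))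
    (int (fun z => inner ℝ z.1 w ^ 2) (by fun_prop))] at e2
  have e3 := setIntegral_steiner_refl Ψ hA hconv hsymm
    (fun z => inner ℝ (Ψ.toEquiv.symm z).1 w * (Ψ.toEquiv.symm z).2)
  simp only [Splitting.refl, ContinuousLinearEquiv.symm_apply_apply, mul_neg, integral_neg] at e3
  have e4 : ∫ z in steiner Ψ A, (inner ℝ (Ψ.toEquiv.symm z).1 w ^ 2 : ℝ) = 0 := by linarith
  rw [integral_eq_zero_iff_of_nonneg_ae (.of_forall fun _ => sq_nonneg _)
    (int (fun z => inner ℝ z.1 w ^ 2) (by fun_prop))] at e4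
  have e5 : ∀ᵐ z ∂volume.restrict (steiner Ψ A), midHeight Ψ A (Ψ.toEquiv.symm z).1 = 0 := by
    filter_upwards [hw, e4] with z h1 h2
    rw [h1]
    simpa using h2
  -- The inverse shear carries the almost-everywhere statement from the symmetral back to `A`.
  have hmp := (Ψ.measurePreserving_shear (measurable_midHeight Ψ hA)).restrict_preimage
    hA.measurableSet
  have hmp' := MeasurePreserving.symm (Ψ.shearEquiv (measurable_midHeight Ψ hA)) hmp
  filter_upwards [hmp'.quasiMeasurePreserving.ae e5]
  rw [Ψ.forall_iff]
  intro x s hx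
  change midHeight Ψ A (Ψ.toEquiv.symm (Ψ.shear (fun x => -midHeight Ψ A x) _)).1 = 0 at hx
  rw [Ψ.shear_apply] at hx
  simpa using hx

end Steiner

end AffineSobolev

namespace AffineSobolev

open scoped Topology

/-! ### Minimizers in isotropic position are Euclidean balls -/

section Reflection

variable {W E : Type*} [NormedAddCommGroup W] [InnerProductSpace ℝ W] [FiniteDimensional ℝ W]
  [MeasurableSpace W] [BorelSpace W]
  [NormedAddCommGroup E] [InnerProductSpace ℝ E] [FiniteDimensional ℝ E]
  [MeasurableSpace E] [BorelSpace E]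

omit [FiniteDimensional ℝ E] [MeasurableSpace E] [BorelSpace E] in
lemma exists_seminorm_unitBody_eq {A : Set E} (hA : IsCompact A) (hconv : Convex ℝ A)
    (hsymm : ∀ z ∈ A, -z ∈ A) (h0 : A ∈ 𝓝 0) :
    ∃ L : Seminorm ℝ E, (∀ x ≠ 0, 0 < L x) ∧ unitBody L = A := by
  refine ⟨gaugeSeminorm ((balanced_iff_neg_mem hconv).2 hsymm) hconv (absorbent_nhds_zero h0),
    fun x hx => ?_, ?_⟩
  · exact (gauge_pos (absorbent_nhds_zero h0)
      (NormedSpace.isVonNBounded_of_isBounded ℝ hA.isBounded)).2 hx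
  · ext x
    change gauge A x ≤ 1 ↔ _
    rw [gauge_le_one_iff_mem_closure hconv h0, hA.isClosed.closure_eq]

/-- If the inequality failed at z, a rescaling of z would lie in the open set where L < 1 and L
exceeds 1 after reflection. A nonempty open set has positive measure, contrary to `h`. -/
lemma seminorm_refl_le (Ψ : Splitting W E) (L : Seminorm ℝ E)
    (h : ∀ᵐ z ∂volume.restrict (unitBody L), Ψ.refl z ∈ unitBody L) (hL : ∀ x ≠ 0, 0 < L x)
    (z : E) : L (Ψ.refl z) ≤ L z := by
  by_contra! hlt
  obtain ⟨t, ht1, ht2⟩ := exists_between hlt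
  have ht : 0 < t := (apply_nonneg L z).trans_lt ht1
  have hcont := seminorm_continuous L
  have hU : IsOpen {z | L z < 1 ∧ 1 < L (Ψ.refl z)} :=
    (isOpen_lt hcont continuous_const).inter
      (isOpen_lt continuous_const (hcont.comp Ψ.continuous_refl))
  have hne : (t⁻¹ • z) ∈ {z | L z < 1 ∧ 1 < L (Ψ.refl z)} := by
    have hr : Ψ.refl (t⁻¹ • z) = t⁻¹ • Ψ.refl z := by
      simp only [Splitting.refl, ← map_smul, Prod.smul_mk, smul_neg]
      simp
    constructor
    · rw [map_smul_eq_mul, norm_inv, Real.norm_of_nonneg ht.le, inv_mul_lt_iff₀ ht]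
      linarith
    · rw [hr, map_smul_eq_mul, norm_inv, Real.norm_of_nonneg ht.le, lt_inv_mul_iff₀ ht]
      linarith
  have hpos := hU.measure_pos volume ⟨_, hne⟩
  refine hpos.ne' (measure_mono_null ?_ ((ae_restrict_iff' (isCompact_unitBody
    hL).measurableSet).1 h))
  rintro z ⟨hz1, hz2⟩ hz
  exact absurd (hz hz1.le) (not_le.2 hz2)

/-- A norm minimizing the centroid ratio, in isotropic position, is invariant under reflections. -/
lemma seminorm_refl_eq {p : ℝ} (hp : 1 < p) (Ψ : Splitting W E) (L : Seminorm ℝ E)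
    (hL : ∀ x ≠ 0, 0 < L x)
    (hmin : ∀ L' : Seminorm ℝ E, (∀ x ≠ 0, 0 < L' x) →
      centroidRatio p (unitBody L) ≤ centroidRatio p (unitBody L'))
    (hiso : ∀ y z : E, inner ℝ y z = (0 : ℝ) →
      ∫ x in unitBody L, inner ℝ x y * inner ℝ x z = (0 : ℝ)) (z : E) :
    L (Ψ.refl z) = L z := by
  set A := unitBody L
  have hA : IsCompact A := isCompact_unitBody hL
  have h0 : A ∈ 𝓝 0 := unitBody_mem_nhds L
  have hconv : Convex ℝ A := by
    have := L.convex_closedBall 0 1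
    rwa [Seminorm.closedBall_zero_eq] at this
  have hsymm : ∀ z ∈ A, -z ∈ A := fun z hz => by
    change L (-z) ≤ 1
    rw [map_neg_eq_map]; exact hz
  have hS := isCompact_steiner Ψ hA hconv hsymm
  have hS0 := steiner_mem_nhds Ψ hA hconv hsymm h0
  obtain ⟨L', hL', hL'S⟩ := exists_seminorm_unitBody_eq hS
    (convex_steiner Ψ hA hconv hsymm) (fun z hz => neg_mem_steiner Ψ hA hconv hsymm hz) hS0
  have hle := hmin L' hL'
  have hApos : 0 < (volume A).toReal := measureReal_pos_of_mem_nhds hA h0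
  rw [hL'S, centroidRatio, centroidRatio, Measure.real, Measure.real, Measure.real, Measure.real,
    volume_steiner Ψ hA, div_le_div_iff_of_pos_right (Real.rpow_pos_of_pos hApos _), ENNReal.toReal_le_toReal
      (isCompact_centroidBody hp hA).measure_lt_top.ne
      (isCompact_centroidBody hp hS).measure_lt_top.ne] at hle
  -- The centroid body is by definition the body supported by `momentSeminorm`. As the symmetral has
  -- the volume of `A`, minimality says that the volume of the centroid body did not drop.
  obtain ⟨y₁, y₂, hy⟩ := exists_eq_of_volume_le (Ψ := Ψ) (H := momentSeminorm hp hA)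
    (H' := momentSeminorm hp hS)
    (fun y => by rw [momentSeminorm_apply, momentSeminorm_apply, moment_steiner_zero Ψ hA])
    (moment_steiner_le Ψ hA hconv hsymm hp)
    (moment_rpow_inv_pos hp hA h0) (moment_rpow_inv_pos hp hS hS0)
    (isCompact_centroidBody hp hS).measure_lt_top.ne hle
  obtain ⟨w, hw⟩ := exists_midHeight_eq_inner Ψ hA hconv hsymm hp h0 y₁ y₂ hy
  have hmid := midHeight_ae_eq_zero Ψ w hconv hsymm hA hw hiso
  have hae : ∀ᵐ z ∂volume.restrict A, Ψ.refl z ∈ A := by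
    filter_upwards [hmid, ae_restrict_mem hA.measurableSet]
    rw [Ψ.forall_iff]
    intro x s hx hs
    rw [ContinuousLinearEquiv.symm_apply_apply] at hx
    rw [Ψ.refl_apply]
    refine mem_of_mem_Icc Ψ hA hconv hsymm hs ?_
    have h1 := mem_Icc_of_mem Ψ hA hsymm hs
    simp only [midHeight] at hx
    rw [Set.mem_Icc] at *
    constructor <;> linarith [h1.1, h1.2]
  refine le_antisymm (seminorm_refl_le Ψ L hae hL z) ?_
  have := seminorm_refl_le Ψ L hae hL (Ψ.refl z)
  rwa [Ψ.refl_refl] at this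

lemma refl_eq_of_splitting {u : E} (Ψ : Splitting (ℝ ∙ u)ᗮ E) (hu : ‖u‖ = 1)
    (hΨ : ∀ z, Ψ.toEquiv z = (z.1 : E) + z.2 • u) (z : E) :
    Ψ.refl z = z - (2 * inner ℝ z u) • u := by
  revert z
  rw [Ψ.forall_iff]
  intro x s
  rw [Ψ.refl_apply, hΨ, hΨ]
  have h2 : inner ℝ (x : E) u = 0 := Submodule.mem_orthogonal_singleton_iff_inner_left.1 x.2
  simp only [inner_add_left, inner_smul_left, h2, real_inner_self_eq_norm_sq, hu]
  simp only [conj_trivial, one_pow, mul_one, zero_add, mul_smul, two_smul, neg_smul]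
  abel

/-- A norm minimizing the centroid ratio, in isotropic position, is Euclidean. -/
lemma exists_eq_mul_norm {p : ℝ} (hp : 1 < p) (L : Seminorm ℝ E)
    (hL : ∀ x ≠ 0, 0 < L x)
    (hmin : ∀ L' : Seminorm ℝ E, (∀ x ≠ 0, 0 < L' x) →
      centroidRatio p (unitBody L) ≤ centroidRatio p (unitBody L'))
    (hiso : ∀ y z : E, inner ℝ y z = (0 : ℝ) →
      ∫ x in unitBody L, inner ℝ x y * inner ℝ x z = (0 : ℝ)) :
    ∃ c, 0 < c ∧ ∀ x, L x = c * ‖x‖ := by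
  have hsph : ∀ x y : E, ‖x‖ = ‖y‖ → L x = L y := by
    intro x y hxy
    rcases eq_or_ne x y with rfl | hne
    · rfl
    have hd : 0 < ‖x - y‖ := norm_pos_iff.2 (sub_ne_zero.2 hne)
    -- Two vectors of equal length are exchanged by the reflection in the hyperplane orthogonal to
    -- their difference.
    set u := ‖x - y‖⁻¹ • (x - y) with hu
    have hu1 : ‖u‖ = 1 := by rw [hu, norm_smul, norm_inv, norm_norm, inv_mul_cancel₀ hd.ne']
    obtain ⟨Ψ, hΨ⟩ := exists_splitting u hu1
    have h := seminorm_refl_eq hp Ψ L hL hmin hiso x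
    rw [refl_eq_of_splitting Ψ hu1 hΨ] at h
    have h2 : (2 * inner ℝ x u) • u = x - y := by
      rw [hu, inner_smul_right, smul_smul]
      have h3 : 2 * inner ℝ x (x - y) = ‖x - y‖ ^ 2 := by
        rw [norm_sub_sq_real, inner_sub_right, real_inner_self_eq_norm_sq, ← hxy]; ring
      have h4 : 2 * (‖x - y‖⁻¹ * inner ℝ x (x - y)) * ‖x - y‖⁻¹ = 1 := by
        rw [mul_left_comm, h3]; field_simp
      rw [h4, one_smul]
    rw [h2, sub_sub_cancel] at h
    exact h.symm
  rcases subsingleton_or_nontrivial E with hs | hs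
  · exact ⟨1, one_pos, fun x => by simp [Subsingleton.elim x 0]⟩
  obtain ⟨e, he⟩ := exists_norm_eq E zero_le_one
  refine ⟨L e, hL e (by rintro rfl; simp at he), fun x => ?_⟩
  have h := hsph x (‖x‖ • e) (by rw [norm_smul, norm_norm, he, mul_one])
  rw [h, map_smul_eq_mul, norm_norm, mul_comm]

end Reflection

/-! ### Isotropic position and the L_p Busemann-Petty centroid inequality -/

section Isotropic

variable {n : ℕ}

open scoped MatrixOrder Matrix.Norms.L2Operator in
/-- Every convex body has a linear image in isotropic position. -/
lemma exists_isotropic {A : Set (EuclideanSpace ℝ (Fin n))} (hA : IsCompact A) (h0 : A ∈ 𝓝 0) :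
    ∃ T : EuclideanSpace ℝ (Fin n) ≃ₗ[ℝ] EuclideanSpace ℝ (Fin n),
      ∀ y z : EuclideanSpace ℝ (Fin n), inner ℝ y z = (0 : ℝ) →
        ∫ x in T ⁻¹' A, inner ℝ x y * inner ℝ x z = (0 : ℝ) := by
  set S : Matrix (Fin n) (Fin n) ℝ := Matrix.of fun i j => ∫ x in A, x i * x j with hS
  have hint : ∀ y z : EuclideanSpace ℝ (Fin n),
      ∫ x in A, inner ℝ x y * inner ℝ x z = (y.ofLp ⬝ᵥ (S.mulVec z.ofLp) : ℝ) := by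
    intro y z
    have e1 : ∀ x : EuclideanSpace ℝ (Fin n), (inner ℝ x y * inner ℝ x z : ℝ) =
        ∑ i, ∑ j, y i * (z j * (x i * x j)) := by
      intro x
      simp only [PiLp.inner_apply, RCLike.inner_apply, conj_trivial]
      rw [Finset.sum_mul_sum]
      exact Finset.sum_congr rfl fun i _ => Finset.sum_congr rfl fun j _ => by ring
    simp only [e1]
    have hi : ∀ i j, IntegrableOn (fun x : EuclideanSpace ℝ (Fin n) => y i * (z j * (x i * x j))) A :=
      fun i j => (Continuous.continuousOn (by fun_prop)).integrableOn_compact hA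
    rw [integral_finsetSum _ fun i _ => integrable_finsetSum _ fun j _ => hi i j]
    simp only [dotProduct, Matrix.mulVec, Finset.mul_sum]
    refine Finset.sum_congr rfl fun i _ => ?_
    rw [integral_finsetSum _ fun j _ => hi i j]
    refine Finset.sum_congr rfl fun j _ => ?_
    rw [integral_const_mul, integral_const_mul, hS, Matrix.of_apply]
    ring
  have hpsd : S.PosSemidef := by
    refine .of_dotProduct_mulVec_nonneg ?_ fun x => ?_
    · ext i j
      simp [hS, mul_comm]
    · rw [star_trivial]
      have := hint (WithLp.toLp 2 x) (WithLp.toLp 2 x)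
      rw [← this]
      exact integral_nonneg fun _ => mul_self_nonneg _
  -- Factor the moment matrix as S = BᵀB and pull back by T = b^*. The form of T⁻¹(A) at (by, bz) is
  -- a multiple of that of `A` at (y, z), which equals ⟨by, bz⟩.
  obtain ⟨B, hB⟩ := CStarAlgebra.nonneg_iff_eq_star_mul_self.mp hpsd.nonneg
  set b := Matrix.toEuclideanLin B
  have hinner : ∀ y z : EuclideanSpace ℝ (Fin n),
      ∫ x in A, inner ℝ x y * inner ℝ x z = (inner ℝ (b y) (b z) : ℝ) := by
    intro y z
    rw [hint, hB, ← Matrix.mulVec_mulVec, Matrix.star_eq_conjTranspose,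
      Matrix.dotProduct_mulVec, Matrix.conjTranspose_eq_transpose_of_trivial, Matrix.vecMul_transpose]
    simp [b, EuclideanSpace.inner_eq_star_dotProduct, dotProduct_comm]
  have hbinj : Function.Injective b := by
    rw [injective_iff_map_eq_zero]
    intro y hy
    by_contra hne
    have h1 := moment_pos (p := 2) (by norm_num) hA h0 hne
    have h2 := hinner y y
    rw [hy, inner_zero_left] at h2
    have h3 : moment 2 A y = ∫ x in A, (inner ℝ x y * inner ℝ x y : ℝ) := by
      rw [moment]
      congr 1
      ext x
      rw [Real.rpow_two, sq_abs, sq]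
    linarith
  set e := LinearEquiv.ofInjectiveEndo b hbinj
  have hsurj := adjoint_surjective e
  have hadj : LinearMap.adjoint (e : _ →ₗ[ℝ] _) = LinearMap.adjoint b := rfl
  rw [hadj] at hsurj
  refine ⟨LinearEquiv.ofInjectiveEndo (LinearMap.adjoint b)
    (LinearMap.injective_iff_surjective.2 hsurj), fun y z hyz => ?_⟩
  set T := LinearEquiv.ofInjectiveEndo (LinearMap.adjoint b)
    (LinearMap.injective_iff_surjective.2 hsurj) with hT
  have hbs := LinearMap.injective_iff_surjective.1 hbinj
  obtain ⟨y, rfl⟩ := hbs y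
  obtain ⟨z, rfl⟩ := hbs z
  have h := setIntegral_preimage_linear T hA.measurableSet
    (fun x => (inner ℝ x y * inner ℝ x z : ℝ))
  rw [hinner, hyz, mul_zero] at h
  rw [← h]
  congr 1
  ext x
  have : T x = LinearMap.adjoint b x := rfl
  rw [this, LinearMap.adjoint_inner_left, LinearMap.adjoint_inner_left]

/-- A norm minimizing the centroid ratio is the pullback of the Euclidean norm. -/
lemma exists_linear_of_minimizer {p : ℝ} (hp : 1 < p)
    (L : Seminorm ℝ (EuclideanSpace ℝ (Fin n))) (hL : ∀ x ≠ 0, 0 < L x)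
    (hmin : ∀ L' : Seminorm ℝ (EuclideanSpace ℝ (Fin n)), (∀ x ≠ 0, 0 < L' x) →
      centroidRatio p (unitBody L) ≤ centroidRatio p (unitBody L')) :
    ∃ T : EuclideanSpace ℝ (Fin n) ≃ₗ[ℝ] EuclideanSpace ℝ (Fin n),
      ∀ x, L (T x) = ‖x‖ := by
  have hA := isCompact_unitBody hL
  obtain ⟨T, hT⟩ := exists_isotropic hA (unitBody_mem_nhds L)
  obtain ⟨c, hc, h⟩ := exists_eq_mul_norm hp (L.comp T.toLinearMap)
    (fun x hx => hL (T x) (by simpa using hx)) (fun L' hL' => by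
      rw [unitBody_comp, centroidRatio_preimage hp T hA.measurableSet]
      exact hmin L' hL') (by rw [unitBody_comp]; exact hT)
  refine ⟨(LinearEquiv.smulOfNeZero ℝ _ c⁻¹ (by positivity)).trans T, fun x => ?_⟩
  have := h (c⁻¹ • x)
  rw [norm_smul, norm_inv, Real.norm_of_nonneg hc.le, mul_inv_cancel_left₀ hc.ne'] at this
  exact this

lemma centroidRatio_eq_of_norm {p : ℝ} (hp : 1 < p)
    {L : Seminorm ℝ (EuclideanSpace ℝ (Fin n))} (hL : ∀ x ≠ 0, 0 < L x)
    {T : EuclideanSpace ℝ (Fin n) ≃ₗ[ℝ] EuclideanSpace ℝ (Fin n)} (hT : ∀ x, L (T x) = ‖x‖) :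
    centroidRatio p (unitBody L) =
      centroidRatio p (Metric.closedBall (0 : EuclideanSpace ℝ (Fin n)) 1) := by
  rw [← centroidRatio_preimage hp T (isCompact_unitBody hL).measurableSet]
  congr 1
  ext x
  simp [unitBody, hT]

/-- The `L_p` Busemann-Petty centroid inequality for norms. -/
theorem centroidRatio_closedBall_le {p : ℝ} (hp : 1 < p)
    (L : Seminorm ℝ (EuclideanSpace ℝ (Fin n))) (hL : ∀ x ≠ 0, 0 < L x) :
    centroidRatio p (Metric.closedBall (0 : EuclideanSpace ℝ (Fin n)) 1) ≤
      centroidRatio p (unitBody L) := by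
  obtain ⟨L₀, hL₀, hmin⟩ := exists_minimizer (n := n) hp
  obtain ⟨T, hT⟩ := exists_linear_of_minimizer hp L₀ hL₀ hmin
  rw [← centroidRatio_eq_of_norm hp hL₀ hT]
  exact hmin L hL

/-- The equality case of the `L_p` Busemann-Petty centroid inequality for norms. -/
theorem exists_linear_of_centroidRatio_eq {p : ℝ} (hp : 1 < p)
    (L : Seminorm ℝ (EuclideanSpace ℝ (Fin n))) (hL : ∀ x ≠ 0, 0 < L x)
    (h : centroidRatio p (unitBody L) =
      centroidRatio p (Metric.closedBall (0 : EuclideanSpace ℝ (Fin n)) 1)) :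
    ∃ T : EuclideanSpace ℝ (Fin n) ≃ₗ[ℝ] EuclideanSpace ℝ (Fin n),
      ∀ x, L (T x) = ‖x‖ :=
  exists_linear_of_minimizer hp L hL fun L' hL' => by
    rw [h]; exact centroidRatio_closedBall_le hp L' hL'

end Isotropic

end AffineSobolev

namespace AffineSobolev

open scoped Topology

/-! ### Polar coordinates over the unit ball of a norm -/

section Polar

variable {n : ℕ}

lemma integral_polar (hn : 1 ≤ n) {G : EuclideanSpace ℝ (Fin n) → ℝ} (hG : Integrable G) :
    ∫ x, G x = sphereIntegral fun ξ => ∫ r in Set.Ioi (0 : ℝ), r ^ (n - 1) * G (r • ξ) := by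
  have : Nonempty (Fin n) := ⟨⟨0, hn⟩⟩
  have hd : Module.finrank ℝ (EuclideanSpace ℝ (Fin n)) = n := finrank_euclideanSpace_fin
  have hmp := (volume : Measure (EuclideanSpace ℝ (Fin n))).measurePreserving_homeomorphUnitSphereProd
  have hemb := (homeomorphUnitSphereProd (EuclideanSpace ℝ (Fin n))).measurableEmbedding
  let g : Metric.sphere (0 : EuclideanSpace ℝ (Fin n)) 1 × Set.Ioi (0 : ℝ) → ℝ :=
    fun z => G (z.2.1 • z.1.1)
  have hcomp : ∀ x : ({0}ᶜ : Set (EuclideanSpace ℝ (Fin n))), g (homeomorphUnitSphereProd (EuclideanSpace ℝ (Fin n)) x) = G x := by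
    intro x
    have hx : ‖x.1‖ ≠ 0 := norm_ne_zero_iff.2 x.2
    simp [g, smul_smul, hx]
  have hint : Integrable g (volume.toSphere.prod (.volumeIoiPow (Module.finrank ℝ (EuclideanSpace ℝ (Fin n)) - 1))) := by
    rw [← hmp.integrable_comp_emb hemb]
    have : g ∘ homeomorphUnitSphereProd (EuclideanSpace ℝ (Fin n)) = G ∘ Subtype.val := funext hcomp
    rw [this, ← integrableOn_iff_comap_subtypeVal (measurableSet_singleton _).compl]
    exact hG.integrableOn
  calc ∫ x, G x = ∫ x : ({(0)}ᶜ : Set (EuclideanSpace ℝ (Fin n))), G x.1 ∂(volume.comap Subtype.val) := by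
        rw [integral_subtype_comap (measurableSet_singleton _).compl fun x ↦ G x,
          restrict_compl_singleton]
    _ = ∫ z, g z ∂volume.toSphere.prod (.volumeIoiPow (Module.finrank ℝ (EuclideanSpace ℝ (Fin n)) - 1)) := by
        rw [← hmp.integral_comp hemb]
        exact integral_congr_ae (.of_forall fun x => (hcomp x).symm)
    _ = ∫ ξ, ∫ r, g (ξ, r) ∂(.volumeIoiPow (Module.finrank ℝ (EuclideanSpace ℝ (Fin n)) - 1)) ∂volume.toSphere :=
        integral_prod _ hint
    _ = _ := by
        rw [sphereIntegral]
        refine integral_congr_ae (.of_forall fun ξ => ?_)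
        simp only [Measure.volumeIoiPow, ENNReal.ofReal, hd]
        rw [integral_withDensity_eq_integral_smul]
        · rw [integral_subtype_comap measurableSet_Ioi
            fun a ↦ Real.toNNReal (a ^ (n - 1)) • G (a • ξ.1),
            setIntegral_congr_fun measurableSet_Ioi fun x hx ↦ ?_]
          rw [NNReal.smul_def, Real.coe_toNNReal _ (pow_nonneg hx.out.le _), smul_eq_mul]
        · exact (measurable_subtype_coe.pow_const _).real_toNNReal

/-- Integral of a homogeneous function over the unit ball of a norm. -/
lemma setIntegral_unitBody (hn : 1 ≤ n) {L : Seminorm ℝ (EuclideanSpace ℝ (Fin n))}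
    (hL : ∀ x ≠ 0, 0 < L x) {a : ℝ} (ha : 0 ≤ a) {φ : EuclideanSpace ℝ (Fin n) → ℝ}
    (hφ : ∀ r : ℝ, 0 < r → ∀ x, φ (r • x) = r ^ a * φ x) (hint : IntegrableOn φ (unitBody L)) :
    ∫ x in unitBody L, φ x =
      (n + a)⁻¹ * sphereIntegral fun ξ => L ξ ^ (-(n : ℝ) - a) * φ ξ := by
  have hn' : (1 : ℝ) ≤ n := by exact_mod_cast hn
  have hm := (isCompact_unitBody hL).measurableSet
  rw [← integral_indicator hm, integral_polar hn ((integrable_indicator_iff hm).2 hint),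
    sphereIntegral, sphereIntegral, ← integral_const_mul]
  refine integral_congr_ae (.of_forall fun ξ => ?_)
  have hξ0 : (ξ : EuclideanSpace ℝ (Fin n)) ≠ 0 := by
    intro h
    have := ξ.2
    rw [h] at this
    simp at this
  have hl := hL ξ hξ0
  set l := L (ξ : EuclideanSpace ℝ (Fin n)) with hldef
  have e1 : ∀ r ∈ Set.Ioi (0 : ℝ), r ^ (n - 1) * (unitBody L).indicator φ (r • ξ.1) =
      (Set.Ioc 0 l⁻¹).indicator (fun r => r ^ ((n : ℝ) + a - 1) * φ ξ) r := by
    intro r hr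
    have hr : (0 : ℝ) < r := hr
    have hmem : r • ξ.1 ∈ unitBody L ↔ r ∈ Set.Ioc 0 l⁻¹ := by
      simp only [unitBody, Set.mem_ofPred_eq, map_smul_eq_mul, Real.norm_of_nonneg hr.le,
        Set.mem_Ioc, hr, true_and]
      rw [← one_div, le_div_iff₀ hl]
    by_cases h : r • ξ.1 ∈ unitBody L
    · rw [Set.indicator_of_mem h, Set.indicator_of_mem (hmem.1 h), hφ r hr, ← mul_assoc,
        ← Real.rpow_natCast, ← Real.rpow_add hr, Nat.cast_sub hn]
      congr 2
      push_cast; ring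
    · rw [Set.indicator_of_notMem h, Set.indicator_of_notMem (mt hmem.2 h), mul_zero]
  dsimp only
  rw [setIntegral_congr_fun measurableSet_Ioi e1, setIntegral_indicator measurableSet_Ioc,
    Set.inter_eq_right.2 fun r hr => hr.1, integral_mul_const,
    ← intervalIntegral.integral_of_le (by positivity), integral_rpow (Or.inl (by linarith))]
  rw [sub_add_cancel, Real.zero_rpow (by linarith), sub_zero, Real.inv_rpow hl.le,
    ← Real.rpow_neg hl.le, neg_add']
  field_simp
  rw [mul_comm]

end Polar

/-! ### Moments of the Euclidean sphere via Gaussian integrals -/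

section Constants

lemma integral_abs_rpow_mul_exp {p : ℝ} (hp : -1 < p) :
    ∫ t : ℝ, |t| ^ p * Real.exp (-|t| ^ (2 : ℝ)) = Real.Gamma ((p + 1) / 2) := by
  rw [integral_comp_abs (f := fun t => t ^ p * Real.exp (-t ^ (2 : ℝ))),
    integral_rpow_mul_exp_neg_rpow (by norm_num) hp]
  ring

/-- The integral of a non-integrable function is 0 by convention, whereas the value computed above
is positive. -/
lemma integrable_abs_rpow_mul_exp {p : ℝ} (hp : -1 < p) :
    Integrable fun t : ℝ => |t| ^ p * Real.exp (-|t| ^ (2 : ℝ)) := by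
  by_contra h
  have := integral_undef h
  rw [integral_abs_rpow_mul_exp hp] at this
  exact (Real.Gamma_pos_of_pos (by linarith)).ne' this

variable {n : ℕ}

lemma gaussian_eq_prod (p : ℝ) (i : Fin n) (x : EuclideanSpace ℝ (Fin n)) :
    |x i| ^ p * Real.exp (-‖x‖ ^ (2 : ℝ)) =
      ∏ j, |x.ofLp j| ^ (if j = i then p else 0) * Real.exp (-|x.ofLp j| ^ (2 : ℝ)) := by
  rw [Finset.prod_mul_distrib, ← Real.exp_sum]
  congr 1
  · rw [Finset.prod_eq_single i (fun j _ hj => by simp [hj]) (by simp)]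
    simp
  · congr 1
    rw [Real.rpow_two, EuclideanSpace.norm_sq_eq, Finset.sum_neg_distrib]
    simp

lemma integrable_gaussian {p : ℝ} (hp : 0 ≤ p) (i : Fin n) :
    Integrable fun x : EuclideanSpace ℝ (Fin n) => |x i| ^ p * Real.exp (-‖x‖ ^ (2 : ℝ)) := by
  simp only [gaussian_eq_prod]
  have h := Integrable.fintype_prod (μ := fun _ : Fin n => (volume : Measure ℝ))
    (f := fun j t => |t| ^ (if j = i then p else 0) * Real.exp (-|t| ^ (2 : ℝ)))
    fun j => integrable_abs_rpow_mul_exp (by split_ifs <;> linarith)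
  exact (PiLp.volume_preserving_ofLp (Fin n)).integrable_comp_of_integrable h

lemma integral_gaussian' {p : ℝ} (hp : 0 ≤ p) (i : Fin n) :
    ∫ x : EuclideanSpace ℝ (Fin n), |x i| ^ p * Real.exp (-‖x‖ ^ (2 : ℝ)) =
      Real.Gamma ((p + 1) / 2) * Real.pi ^ (((n : ℝ) - 1) / 2) := by
  simp only [gaussian_eq_prod]
  rw [(PiLp.volume_preserving_ofLp (Fin n)).integral_comp
    (MeasurableEquiv.toLp 2 (Fin n → ℝ)).symm.measurableEmbedding
    (fun x : Fin n → ℝ => ∏ j, |x j| ^ (if j = i then p else 0) * Real.exp (-|x j| ^ (2 : ℝ)))]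
  rw [integral_fintype_prod_volume_eq_prod
    (f := fun j t => |t| ^ (if j = i then p else 0) * Real.exp (-|t| ^ (2 : ℝ)))]
  have h : ∀ j, ∫ t : ℝ, |t| ^ (if j = i then p else 0) * Real.exp (-|t| ^ (2 : ℝ)) =
      Real.Gamma (((if j = i then p else 0) + 1) / 2) := fun j =>
    integral_abs_rpow_mul_exp (by split_ifs <;> linarith)
  simp only [h]
  rw [← Finset.mul_prod_erase _ _ (Finset.mem_univ i)]
  simp only [if_true]
  congr 1
  rw [Finset.prod_congr rfl (g := fun _ => Real.pi ^ (1 / 2 : ℝ))]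
  · rw [Finset.prod_const, Finset.card_erase_of_mem (Finset.mem_univ i), Finset.card_univ,
      Fintype.card_fin, ← Real.rpow_natCast, ← Real.rpow_mul Real.pi_pos.le,
      Nat.cast_sub (by have := i.2; omega)]
    congr 1
    push_cast; ring
  · intro j hj
    rw [if_neg (Finset.ne_of_mem_erase hj), zero_add, Real.Gamma_one_half_eq, Real.sqrt_eq_rpow]

lemma integral_inner_gaussian {p : ℝ} (hn : 1 ≤ n) (hp : 0 ≤ p) {y : EuclideanSpace ℝ (Fin n)}
    (hy : ‖y‖ = 1) :
    (Integrable fun x : EuclideanSpace ℝ (Fin n) =>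
      |inner ℝ y x| ^ p * Real.exp (-‖x‖ ^ (2 : ℝ))) ∧
    ∫ x : EuclideanSpace ℝ (Fin n), |inner ℝ y x| ^ p * Real.exp (-‖x‖ ^ (2 : ℝ)) =
      Real.Gamma ((p + 1) / 2) * Real.pi ^ (((n : ℝ) - 1) / 2) := by
  set e : EuclideanSpace ℝ (Fin n) := EuclideanSpace.single ⟨0, hn⟩ 1
  -- This reflection takes the unit vector `y` to a coordinate vector and preserves the Gaussian.
  set ρ := (ℝ ∙ (y - e))ᗮ.reflection
  have hρ : ρ y = e := Submodule.reflection_sub (by simp [e, hy])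
  have h : ∀ x, |inner ℝ y x| ^ p * Real.exp (-‖x‖ ^ (2 : ℝ)) =
      |(ρ x) ⟨0, hn⟩| ^ p * Real.exp (-‖ρ x‖ ^ (2 : ℝ)) := by
    intro x
    rw [ρ.norm_map, ← ρ.inner_map_map y x, hρ]
    simp [e, EuclideanSpace.inner_single_left]
  simp only [h]
  refine ⟨ρ.measurePreserving.integrable_comp_of_integrable (integrable_gaussian hp ⟨0, hn⟩), ?_⟩
  rw [← integral_gaussian' hp ⟨0, hn⟩]
  exact ρ.measurePreserving.integral_comp ρ.toHomeomorph.measurableEmbedding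
    (fun x => |x ⟨0, hn⟩| ^ p * Real.exp (-‖x‖ ^ (2 : ℝ)))

/-- The integral over the sphere of the `p`-th power of a linear functional. -/
lemma sphereIntegral_inner_rpow {p : ℝ} (hn : 1 ≤ n) (hp : 1 < p) (y : EuclideanSpace ℝ (Fin n)) :
    sphereIntegral (fun ξ => |inner ℝ y ξ| ^ p) =
      2 * omega (n + p - 2) / omega (p - 1) * ‖y‖ ^ p := by
  have hn' : (1 : ℝ) ≤ n := by exact_mod_cast hn
  have hunit : ∀ y : EuclideanSpace ℝ (Fin n), ‖y‖ = 1 →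
      sphereIntegral (fun ξ => |inner ℝ y ξ| ^ p) = 2 * omega (n + p - 2) / omega (p - 1) := by
    intro y hy
    obtain ⟨h1, h2⟩ := integral_inner_gaussian (p := p) hn (by linarith) hy
    rw [integral_polar hn h1] at h2
    -- The Gaussian integral is computed a second time in polar coordinates; dividing by its radial
    -- factor leaves the spherical moment.
    have h3 : ∀ ξ : Metric.sphere (0 : EuclideanSpace ℝ (Fin n)) 1,
        ∫ r in Set.Ioi (0 : ℝ), r ^ (n - 1) *
          (|inner ℝ y (r • ξ.1)| ^ p * Real.exp (-‖r • ξ.1‖ ^ (2 : ℝ))) =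
        |inner ℝ y ξ.1| ^ p * (1 / 2 * Real.Gamma ((n + p) / 2)) := by
      intro ξ
      have h4 := integral_rpow_mul_exp_neg_rpow (p := 2) (q := n + p - 1) (by norm_num)
        (by linarith)
      rw [sub_add_cancel] at h4
      rw [← h4, ← integral_const_mul]
      refine setIntegral_congr_fun measurableSet_Ioi fun r hr => ?_
      have hr : (0 : ℝ) < r := hr
      rw [inner_smul_right, abs_mul, abs_of_pos hr, Real.mul_rpow hr.le (abs_nonneg _), norm_smul,
        norm_eq_of_mem_sphere, mul_one, Real.norm_of_nonneg hr.le,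
        show (n : ℝ) + p - 1 = ((n - 1 : ℕ) : ℝ) + p by rw [Nat.cast_sub hn]; push_cast; ring,
        Real.rpow_add hr, Real.rpow_natCast]
      ring
    rw [sphereIntegral] at h2 ⊢
    simp only [h3] at h2
    rw [integral_mul_const] at h2
    have hg1 := Real.Gamma_pos_of_pos (by linarith : 0 < ((n : ℝ) + p) / 2)
    have hg2 := Real.Gamma_pos_of_pos (by linarith : 0 < (p + 1) / 2)
    rw [omega, omega, show ((n : ℝ) + p - 2) / 2 + 1 = (n + p) / 2 by ring,
      show (p - 1) / 2 + 1 = (p + 1) / 2 by ring,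
      show ((n : ℝ) + p - 2) / 2 = (n - 1) / 2 + (p - 1) / 2 by ring, Real.rpow_add Real.pi_pos]
    have hpi : (0 : ℝ) < Real.pi ^ ((p - 1) / 2) := by positivity
    field_simp
    linarith
  rcases eq_or_ne y 0 with rfl | hy
  · simp [sphereIntegral, Real.zero_rpow (by linarith : p ≠ 0)]
  have hy' : 0 < ‖y‖ := norm_pos_iff.2 hy
  rw [← hunit (‖y‖⁻¹ • y) (by rw [norm_smul, norm_inv, norm_norm, inv_mul_cancel₀ hy'.ne']),
    sphereIntegral, sphereIntegral, ← integral_mul_const]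
  refine integral_congr_ae (.of_forall fun ξ => ?_)
  dsimp only
  rw [inner_smul_left, conj_trivial, abs_mul, abs_of_pos (inv_pos.2 hy'),
    Real.mul_rpow (by positivity) (abs_nonneg _), mul_right_comm,
    ← Real.mul_rpow (by positivity) hy'.le, inv_mul_cancel₀ hy'.ne', Real.one_rpow, one_mul]

lemma omega_pos {k : ℝ} (hk : -2 < k) : 0 < omega k :=
  div_pos (Real.rpow_pos_of_pos Real.pi_pos _) (Real.Gamma_pos_of_pos (by linarith))

lemma measureReal_closedBall (hn : 1 ≤ n) :
    volume.real (Metric.closedBall (0 : EuclideanSpace ℝ (Fin n)) 1) = omega n := by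
  have : Nonempty (Fin n) := ⟨⟨0, hn⟩⟩
  have h := Real.Gamma_pos_of_pos (by positivity : (0 : ℝ) < n / 2 + 1)
  rw [Measure.real, EuclideanSpace.volume_closedBall, omega]
  simp only [ENNReal.ofReal_one, one_pow, one_mul, Fintype.card_fin]
  rw [ENNReal.toReal_ofReal (by positivity), Real.sqrt_eq_rpow, ← Real.rpow_natCast,
    ← Real.rpow_mul Real.pi_pos.le]
  congr 2
  ring

end Constants

end AffineSobolev

namespace AffineSobolev

open scoped Topology

/-! ### Legendre transform of the p-th power of a norm -/

section Legendre

variable {n : ℕ}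

/-- Sublevel sets of the Legendre transform of the `p`-th power of a norm. -/
lemma legendre_le_one_iff {p q : ℝ} (hpq : p.HolderConjugate q)
    {H : Seminorm ℝ (EuclideanSpace ℝ (Fin n))} (hH : ∀ y ≠ 0, 0 < H y) {b : ℝ} (hb : 0 < b)
    (x : EuclideanSpace ℝ (Fin n)) :
    legendre (fun y => b * H y ^ p) x ≤ 1 ↔
      ∀ y, inner ℝ x y ≤ q ^ (1 / q) * p ^ (1 / p) * b ^ (1 / p) * H y := by
  have hp := hpq.pos
  have hq := hpq.symm.pos
  have hpow : ∀ y, (b ^ (1 / p) * H y) ^ p = b * H y ^ p := fun y => by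
    rw [Real.mul_rpow (by positivity) (apply_nonneg _ _), one_div,
      Real.rpow_inv_rpow hb.le hp.ne']
  have young : ∀ c t : ℝ, 0 ≤ c → 0 ≤ t →
      c * (p ^ (1 / p) * t) - t ^ p ≤ c ^ q / q := by
    intro c t hc ht
    have h := Real.young_inequality_of_nonneg hc (by positivity : 0 ≤ p ^ (1 / p) * t) hpq.symm
    rw [Real.mul_rpow (by positivity) ht, one_div, Real.rpow_inv_rpow hp.le hp.ne',
      mul_div_cancel_left₀ _ hp.ne'] at h
    rw [one_div]
    linarith
  have hbdd : BddAbove (Set.range fun y => inner ℝ x y - b * H y ^ p) := by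
    obtain ⟨r, hr, hrH⟩ := exists_le_seminorm H hH
    set c := ‖x‖ / r / b ^ (1 / p) / p ^ (1 / p)
    refine ⟨c ^ q / q, ?_⟩
    rintro _ ⟨y, rfl⟩
    have h1 := young c (b ^ (1 / p) * H y) (by positivity)
      (mul_nonneg (by positivity) (apply_nonneg _ _))
    rw [hpow] at h1
    have h2 : c * (p ^ (1 / p) * (b ^ (1 / p) * H y)) = ‖x‖ / r * H y := by
      simp only [c]; field_simp
    have h3 : ‖x‖ * ‖y‖ ≤ ‖x‖ / r * H y := by
      rw [div_mul_eq_mul_div, le_div_iff₀ hr]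
      nlinarith [hrH y, norm_nonneg x]
    have := real_inner_le_norm x y
    change inner ℝ x y - b * H y ^ p ≤ _
    linarith
  rw [legendre, ciSup_le_iff hbdd]
  constructor
  · intro h y
    rcases eq_or_ne y 0 with rfl | hy
    · simp
    have ht : 0 < b ^ (1 / p) * H y := mul_pos (by positivity) (hH y hy)
    set t := b ^ (1 / p) * H y with htdef
    -- This scaling makes b H^p equal to q/p, which is where Young's inequality is sharp for the
    -- threshold slope. The bound 1 + q/p = q then gives the constant.
    set σ := (q / p) ^ (1 / p) / t with hσdef
    have hσ : 0 < σ := by positivity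
    have h1 := h (σ • y)
    rw [← hpow, map_smul_eq_mul, Real.norm_of_nonneg hσ.le, mul_left_comm, ← htdef,
      inner_smul_right, hσdef, div_mul_cancel₀ _ ht.ne', one_div,
      Real.rpow_inv_rpow (by positivity) hp.ne', ← one_div] at h1
    have h2 : q / p = q - 1 := by
      have := hpq.inv_add_inv_eq_one
      field_simp at this ⊢
      linarith
    rw [h2, div_mul_eq_mul_div, ← h2] at h1
    have h3 : (q / p) ^ (1 / p) * inner ℝ x y ≤ q * t := by
      rw [← div_le_iff₀ ht]; linarith
    have h4 : q ^ (1 / q) * p ^ (1 / p) * (q / p) ^ (1 / p) = q := by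
      rw [Real.div_rpow hq.le hp.le]
      have : q ^ (1 / q) * q ^ (1 / p) = q := by
        rw [← Real.rpow_add hq, one_div, one_div, add_comm, hpq.inv_add_inv_eq_one, Real.rpow_one]
      have hp' : (p ^ (1 / p) : ℝ) ≠ 0 := by positivity
      field_simp
      exact this
    rw [mul_assoc, ← htdef]
    refine le_of_mul_le_mul_left ?_ (by positivity : 0 < (q / p) ^ (1 / p))
    calc _ ≤ q * t := h3
      _ = (q ^ (1 / q) * p ^ (1 / p) * (q / p) ^ (1 / p)) * t := by rw [h4]
      _ = _ := by ring
  · intro h y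
    -- The value c = q^{1/q} is chosen so that c^q / q = 1.
    have h1 := young (q ^ (1 / q)) (b ^ (1 / p) * H y) (by positivity)
      (mul_nonneg (by positivity) (apply_nonneg _ _))
    rw [hpow, one_div q, Real.rpow_inv_rpow hq.le hq.ne', div_self hq.ne', ← one_div] at h1
    have h2 := h y
    have h3 : q ^ (1 / q) * p ^ (1 / p) * b ^ (1 / p) * H y =
        q ^ (1 / q) * (p ^ (1 / p) * (b ^ (1 / p) * H y)) := by ring
    linarith

end Legendre

/-! ### The norm of directional derivatives and the geometry of its unit ball -/

section Gradient

variable {n : ℕ} {f : EuclideanSpace ℝ (Fin n) → ℝ}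

lemma continuous_gradient (hf : ContDiff ℝ (⊤ : ℕ∞) f) : Continuous (gradient f) :=
  (InnerProductSpace.toDual ℝ _).symm.continuous.comp (hf.continuous_fderiv (by simp))

lemma hasCompactSupport_gradient (hs : HasCompactSupport f) : HasCompactSupport (gradient f) :=
  (hs.fderiv (𝕜 := ℝ)).comp_left (map_zero (InnerProductSpace.toDual ℝ _).symm)

lemma inner_gradient_eq_fderiv (x v : EuclideanSpace ℝ (Fin n)) :
    inner ℝ (gradient f x) v = fderiv ℝ f x v := by
  rw [gradient, InnerProductSpace.toDual_symm_apply]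

lemma memLp_inner_gradient (hf : ContDiff ℝ (⊤ : ℕ∞) f) (hs : HasCompactSupport f) (q : ENNReal)
    (y : EuclideanSpace ℝ (Fin n)) : MemLp (fun x => inner ℝ (gradient f x) y) q volume := by
  have hc := continuous_gradient hf
  refine Continuous.memLp_of_hasCompactSupport (by fun_prop) ?_
  exact (hasCompactSupport_gradient hs).comp_left (g := fun v => inner ℝ v y) (inner_zero_left y)

/-- The directional `L^p` norm of the gradient, as a seminorm in the direction. -/
noncomputable def dirSeminorm {p : ℝ} (hp : 1 < p) (hf : ContDiff ℝ (⊤ : ℕ∞) f)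
    (hs : HasCompactSupport f) : Seminorm ℝ (EuclideanSpace ℝ (Fin n)) :=
  lpSeminorm hp volume (gradient f) fun y => memLp_inner_gradient hf hs _ y

lemma dirNorm_eq {p : ℝ} (hp : 1 < p) (hf : ContDiff ℝ (⊤ : ℕ∞) f)
    (hs : HasCompactSupport f) (ξ : EuclideanSpace ℝ (Fin n)) :
    dirNorm p f ξ = dirSeminorm hp hf hs ξ := rfl

lemma dirSeminorm_rpow {p : ℝ} (hp : 1 < p) (hf : ContDiff ℝ (⊤ : ℕ∞) f)
    (hs : HasCompactSupport f) (ξ : EuclideanSpace ℝ (Fin n)) :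
    dirSeminorm hp hf hs ξ ^ p = ∫ x, |inner ℝ (gradient f x) ξ| ^ p := by
  rw [dirSeminorm, lpSeminorm_apply, one_div, Real.rpow_inv_rpow (by positivity) (by linarith)]

/-- If the norm vanished at ξ, then f would be constant on every line parallel to ξ. Such a line
leaves the compact support, so f would be zero. -/
lemma dirSeminorm_pos {p : ℝ} (hp : 1 < p) (hf : ContDiff ℝ (⊤ : ℕ∞) f)
    (hs : HasCompactSupport f) (hf0 : f ≠ 0) : ∀ ξ ≠ 0, 0 < dirSeminorm hp hf hs ξ := by
  intro ξ hξ
  refine lt_of_le_of_ne (apply_nonneg _ _) fun h0 => hf0 ?_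
  have h1 := dirSeminorm_rpow hp hf hs ξ
  rw [← h0, Real.zero_rpow (by linarith)] at h1
  have hc := continuous_gradient hf
  have hcont : Continuous fun x => |inner ℝ (gradient f x) ξ| ^ p :=
    Continuous.rpow_const (by fun_prop) fun _ => Or.inr (by linarith)
  have h2 := (integral_eq_zero_iff_of_nonneg (fun _ => by positivity)
    (memLp_integrable_abs_rpow hp (memLp_inner_gradient hf hs _ ξ))).1 h1.symm
  have h3 := (Continuous.ae_eq_iff_eq volume hcont continuous_const).1 h2
  have hd : ∀ x, fderiv ℝ f x ξ = 0 := fun x => by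
    have : |inner ℝ (gradient f x) ξ| ^ p = 0 := congrFun h3 x
    rw [Real.rpow_eq_zero (abs_nonneg _) (by linarith), abs_eq_zero] at this
    rwa [inner_gradient_eq_fderiv] at this
  ext x
  have hline : ∀ t : ℝ, HasDerivAt (fun t : ℝ => f (x + t • ξ)) 0 t := by
    intro t
    have e1 : HasFDerivAt f (fderiv ℝ f (x + t • ξ)) (x + t • ξ) :=
      (hf.differentiable (by simp) _).hasFDerivAt
    have e2 : HasDerivAt (fun t : ℝ => x + t • ξ) ξ t := by
      simpa using ((hasDerivAt_id t).smul_const ξ).const_add x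
    have := e1.comp_hasDerivAt t e2
    rwa [hd] at this
  have hconst : ∀ t : ℝ, f (x + t • ξ) = f x := fun t => by
    have := is_const_of_deriv_eq_zero (f := fun t : ℝ => f (x + t • ξ))
      (fun t => (hline t).differentiableAt) (fun t => (hline t).deriv) t 0
    simpa using this
  obtain ⟨R, hR⟩ := hs.isCompact.isBounded.exists_norm_le
  have hξ' : 0 < ‖ξ‖ := norm_pos_iff.2 hξ
  rw [← hconst ((|R| + ‖x‖ + 1) / ‖ξ‖)]
  by_contra hne
  have h4 := hR _ (subset_tsupport f hne)
  have h5 : ‖((|R| + ‖x‖ + 1) / ‖ξ‖) • ξ‖ = |R| + ‖x‖ + 1 := by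
    rw [norm_smul, Real.norm_of_nonneg (by positivity)]; field_simp
  have h6 := norm_sub_le (x + ((|R| + ‖x‖ + 1) / ‖ξ‖) • ξ) x
  rw [add_sub_cancel_left, h5] at h6
  linarith [le_abs_self R]

/-- Fubini for |⟨z, ∇f(x)⟩|^p, which is continuous and, for z in `A`, supported in a product of
compact sets. -/
lemma integral_moment_gradient {p : ℝ} (hp : 1 < p) (hf : ContDiff ℝ (⊤ : ℕ∞) f)
    (hs : HasCompactSupport f) {A : Set (EuclideanSpace ℝ (Fin n))} (hA : IsCompact A) :
    ∫ x, moment p A (gradient f x) = ∫ z in A, dirSeminorm hp hf hs z ^ p := by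
  have hp0 : p ≠ 0 := by linarith
  have hc := continuous_gradient hf
  simp only [moment, dirSeminorm_rpow]
  have hswap := integral_integral_swap (μ := volume) (ν := volume.restrict A)
    (f := fun x z : EuclideanSpace ℝ (Fin n) => |inner ℝ z (gradient f x)| ^ p) ?_
  · rw [hswap]
    simp only [real_inner_comm]
  · set S := tsupport (gradient f)
    have hS : IsCompact S := hasCompactSupport_gradient hs
    have hcont : Continuous (Function.uncurry fun x z : EuclideanSpace ℝ (Fin n) =>
        |inner ℝ z (gradient f x)| ^ p) :=
      Continuous.rpow_const (by fun_prop) fun _ => Or.inr (by linarith)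
    have h1 : IntegrableOn (Function.uncurry fun x z : EuclideanSpace ℝ (Fin n) =>
        |inner ℝ z (gradient f x)| ^ p) (S ×ˢ A) (volume.prod volume) :=
      hcont.continuousOn.integrableOn_compact (hS.prod hA)
    have h2 : IntegrableOn (Function.uncurry fun x z : EuclideanSpace ℝ (Fin n) =>
        |inner ℝ z (gradient f x)| ^ p) (Set.univ ×ˢ A) (volume.prod volume) := by
      refine h1.of_forall_sdiff_eq_zero (MeasurableSet.univ.prod hA.measurableSet) ?_
      rintro ⟨x, z⟩ ⟨⟨-, hz⟩, hx⟩
      have : gradient f x = 0 := image_eq_zero_of_notMem_tsupport fun h => hx ⟨h, hz⟩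
      simp [Function.uncurry, this, Real.zero_rpow hp0]
    rw [IntegrableOn, ← Measure.prod_restrict, Measure.restrict_univ] at h2
    exact h2

lemma integrableOn_seminorm_rpow {p : ℝ} (hp : 1 < p)
    {L : Seminorm ℝ (EuclideanSpace ℝ (Fin n))} (hL : ∀ x ≠ 0, 0 < L x) :
    IntegrableOn (fun z => L z ^ p) (unitBody L) :=
  (Continuous.rpow_const (seminorm_continuous L) fun _ =>
    Or.inr (by linarith)).continuousOn.integrableOn_compact (isCompact_unitBody hL)

lemma sphereIntegral_rpow_neg (hn : 1 ≤ n)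
    {L : Seminorm ℝ (EuclideanSpace ℝ (Fin n))} (hL : ∀ x ≠ 0, 0 < L x) :
    sphereIntegral (fun ξ => L ξ ^ (-(n : ℝ))) = n * volume.real (unitBody L) := by
  have hn' : (n : ℝ) ≠ 0 := by positivity
  have h := setIntegral_unitBody hn hL le_rfl (φ := fun _ => (1 : ℝ)) (by simp)
    (integrableOn_const (isCompact_unitBody hL).measure_lt_top.ne)
  simp only [add_zero, sub_zero, mul_one] at h
  rw [setIntegral_const, smul_eq_mul, mul_one] at h
  rw [h, mul_inv_cancel_left₀ hn']

lemma setIntegral_seminorm_rpow (hn : 1 ≤ n) {p : ℝ} (hp : 1 < p)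
    {L : Seminorm ℝ (EuclideanSpace ℝ (Fin n))} (hL : ∀ x ≠ 0, 0 < L x) :
    ∫ z in unitBody L, L z ^ p = n / (n + p) * volume.real (unitBody L) := by
  rw [setIntegral_unitBody hn hL (by linarith : 0 ≤ p) (fun r hr x => by
      rw [map_smul_eq_mul, Real.norm_of_nonneg hr.le, Real.mul_rpow hr.le (apply_nonneg _ _)])
      (integrableOn_seminorm_rpow hp hL), div_eq_inv_mul, mul_assoc,
    ← sphereIntegral_rpow_neg hn hL]
  congr 2
  ext ξ
  -- The integrands are compared on the whole space; at the origin both vanish by the convention for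
  -- powers of 0.
  rcases eq_or_ne ξ 0 with rfl | hξ
  · have hn' : (n : ℝ) ≠ 0 := by positivity
    rw [map_zero, Real.zero_rpow (by linarith), zero_mul, Real.zero_rpow (neg_ne_zero.2 hn')]
  · rw [← Real.rpow_add (hL ξ hξ)]; congr 1; ring

/-- Radial integration of a p-homogeneous function over the unit ball yields the weight L^{-n-p} and
the factor 1/(n+p). -/
lemma CStar_eq (hn : 1 ≤ n) {p : ℝ} (hp : 1 < p) (hf : ContDiff ℝ (⊤ : ℕ∞) f)
    (hs : HasCompactSupport f) (hf0 : f ≠ 0) (y : EuclideanSpace ℝ (Fin n)) :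
    CStar p f y = (n + p) * moment p (unitBody (dirSeminorm hp hf hs)) y := by
  have hL := dirSeminorm_pos hp hf hs hf0
  have hnp : (n : ℝ) + p ≠ 0 := by positivity
  rw [moment, setIntegral_unitBody hn hL (by linarith : 0 ≤ p) (fun r hr x => by
      rw [inner_smul_left, conj_trivial, abs_mul, abs_of_pos hr,
        Real.mul_rpow hr.le (abs_nonneg _)])
      (integrableOn_moment hp (isCompact_unitBody hL) y), mul_inv_cancel_left₀ hnp, CStar]
  simp only [dirNorm_eq hp hf hs, real_inner_comm]

lemma integral_CStar_gradient (hn : 1 ≤ n) {p : ℝ} (hp : 1 < p) (hf : ContDiff ℝ (⊤ : ℕ∞) f)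
    (hs : HasCompactSupport f) (hf0 : f ≠ 0) :
    ∫ x, CStar p f (gradient f x) = n * volume.real (unitBody (dirSeminorm hp hf hs)) := by
  have hL := dirSeminorm_pos hp hf hs hf0
  have hnp : (n : ℝ) + p ≠ 0 := by positivity
  simp only [CStar_eq hn hp hf hs hf0]
  rw [integral_const_mul, integral_moment_gradient hp hf hs (isCompact_unitBody hL),
    setIntegral_seminorm_rpow hn hp hL]
  field_simp

/-- `CStar` is n+p times the p-th power of the support function of the centroid body, so
`legendre_le_one_iff` exhibits `K` as a dilate of that body. -/
lemma volume_K (hn : 1 ≤ n) {p q : ℝ} (hpq : p.HolderConjugate q) (hf : ContDiff ℝ (⊤ : ℕ∞) f)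
    (hs : HasCompactSupport f) (hf0 : f ≠ 0) :
    volume.real (K p f) = (q ^ (1 / q) * p ^ (1 / p) * (n + p) ^ (1 / p)) ^ n *
      volume.real (centroidBody p (unitBody (dirSeminorm hpq.lt hf hs))) := by
  have hp := hpq.lt
  have hp0 := hpq.pos
  have hq0 := hpq.symm.pos
  have hL := dirSeminorm_pos hp hf hs hf0
  have hA := isCompact_unitBody hL
  have hnp : (0 : ℝ) < n + p := by positivity
  set s := q ^ (1 / q) * p ^ (1 / p) * ((n : ℝ) + p) ^ (1 / p) with hsdef
  have hs0 : 0 < s := by positivity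
  have hset : K p f = (fun x => s⁻¹ • x) ⁻¹'
      centroidBody p (unitBody (dirSeminorm hp hf hs)) := by
    ext x
    have hF : CStar p f = fun y => ((n : ℝ) + p) * momentSeminorm hp hA y ^ p := by
      ext y
      rw [CStar_eq hn hp hf hs hf0, moment_eq_rpow hp hA]
    rw [K, Set.mem_ofPred_eq, hF, legendre_le_one_iff hpq
      (moment_rpow_inv_pos hp hA (unitBody_mem_nhds _)) hnp, ← hsdef]
    refine forall_congr' fun y => ?_
    rw [inner_smul_left, conj_trivial, inv_mul_le_iff₀ hs0]
    rfl
  rw [hset, Measure.real, Measure.addHaar_preimage_smul _ (inv_ne_zero hs0.ne'),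
    ENNReal.toReal_mul, finrank_euclideanSpace_fin, inv_pow, inv_inv,
    abs_of_pos (by positivity), ENNReal.toReal_ofReal (by positivity)]
  rfl

end Gradient

end AffineSobolev

namespace AffineSobolev

/-! ### The centroid ratio of the Euclidean ball -/

section Ball

variable {n : ℕ}

/-- The integral over the sphere of the `p`-th power of a coordinate. -/
noncomputable def sphereMoment (n : ℕ) (p : ℝ) : ℝ := 2 * omega (n + p - 2) / omega (p - 1)

lemma sphereMoment_pos (hn : 1 ≤ n) {p : ℝ} (hp : 1 < p) : 0 < sphereMoment n p := by
  have hn' : (1 : ℝ) ≤ n := by exact_mod_cast hn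
  have h1 := omega_pos (k := n + p - 2) (by linarith)
  have h2 := omega_pos (k := p - 1) (by linarith)
  unfold sphereMoment
  positivity

lemma unitBody_normSeminorm : unitBody (normSeminorm ℝ (EuclideanSpace ℝ (Fin n))) =
    Metric.closedBall 0 1 := by
  ext x
  simp [unitBody]

lemma normSeminorm_pos : ∀ x : EuclideanSpace ℝ (Fin n), x ≠ 0 →
    0 < normSeminorm ℝ (EuclideanSpace ℝ (Fin n)) x := fun _ hx => norm_pos_iff.2 hx

lemma moment_closedBall (hn : 1 ≤ n) {p : ℝ} (hp : 1 < p) (y : EuclideanSpace ℝ (Fin n)) :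
    moment p (Metric.closedBall 0 1) y = sphereMoment n p / (n + p) * ‖y‖ ^ p := by
  rw [← unitBody_normSeminorm, moment, setIntegral_unitBody hn normSeminorm_pos
    (by linarith : 0 ≤ p) (fun r hr x => by
      rw [inner_smul_left, conj_trivial, abs_mul, abs_of_pos hr,
        Real.mul_rpow hr.le (abs_nonneg _)])
      (integrableOn_moment hp (isCompact_unitBody normSeminorm_pos) y)]
  have h := sphereIntegral_inner_rpow hn hp y
  have h2 : sphereIntegral (fun ξ => normSeminorm ℝ (EuclideanSpace ℝ (Fin n)) ξ ^ (-(n : ℝ) - p) *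
      |inner ℝ ξ y| ^ p) = sphereIntegral (fun ξ => |inner ℝ y ξ| ^ p) := by
    unfold sphereIntegral
    refine integral_congr_ae (.of_forall fun ξ => ?_)
    simp [real_inner_comm]
  rw [h2, h, sphereMoment]
  ring

lemma a₁_eq (hn : 1 ≤ n) {p : ℝ} (hp : 1 < p) :
    a₁ n p = sphereMoment n p / ((n + p) * omega n) := by
  have hn' : (1 : ℝ) ≤ n := by exact_mod_cast hn
  have h1 := omega_pos (k := n + p - 2) (by linarith)
  have h2 := omega_pos (k := p - 1) (by linarith)
  have h3 := omega_pos (k := n) (by linarith)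
  have hω2 : omega 2 = Real.pi := by
    rw [omega, div_self two_ne_zero, Real.rpow_one, Real.Gamma_add_one one_ne_zero, Real.Gamma_one]
    simp
  -- The recursion for ball volumes in steps of two dimensions, from the functional equation of Γ.
  have hω : omega (n + p) = 2 * Real.pi / (n + p) * omega (n + p - 2) := by
    have hΓ := Real.Gamma_pos_of_pos (by linarith : 0 < ((n : ℝ) + p) / 2)
    rw [omega, omega, Real.Gamma_add_one (by linarith),
      show ((n : ℝ) + p - 2) / 2 + 1 = (n + p) / 2 by ring,
      show ((n : ℝ) + p) / 2 = (n + p - 2) / 2 + 1 by ring, Real.rpow_add Real.pi_pos,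
      Real.rpow_one, show ((n : ℝ) + p - 2) / 2 + 1 = (n + p) / 2 by ring]
    have : (n : ℝ) + p ≠ 0 := by linarith
    field_simp
  have hπ := Real.pi_pos
  have : (n : ℝ) + p ≠ 0 := by linarith
  rw [a₁, hω, hω2, sphereMoment]
  field_simp

lemma volume_centroidBody_closedBall (hn : 1 ≤ n) {p : ℝ} (hp : 1 < p) :
    volume.real (centroidBody p (Metric.closedBall (0 : EuclideanSpace ℝ (Fin n)) 1)) =
      ((sphereMoment n p / (n + p)) ^ (1 / p)) ^ n * omega n := by
  have hκ := sphereMoment_pos hn hp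
  have hp0 : p ≠ 0 := by linarith
  set s := (sphereMoment n p / (n + p)) ^ (1 / p) with hs
  have hs0 : 0 < s := by positivity
  have : centroidBody p (Metric.closedBall (0 : EuclideanSpace ℝ (Fin n)) 1) =
      Metric.closedBall 0 s := by
    ext x
    have h1 : x ∈ centroidBody p (Metric.closedBall (0 : EuclideanSpace ℝ (Fin n)) 1) ↔
        ∀ y, inner ℝ x y ≤ s * ‖y‖ := by
      refine forall_congr' fun y => ?_
      rw [moment_closedBall hn hp, Real.mul_rpow (by positivity) (by positivity), ← hs, one_div,
        Real.rpow_rpow_inv (norm_nonneg _) hp0]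
    rw [h1, mem_closedBall_zero_iff]
    constructor
    · intro h
      have h2 := h x
      rw [real_inner_self_eq_norm_sq] at h2
      by_contra! hlt
      nlinarith [norm_nonneg x]
    · exact fun h y => (real_inner_le_norm x y).trans
        (mul_le_mul_of_nonneg_right h (norm_nonneg y))
  rw [this, Measure.real, Measure.addHaar_closedBall' _ _ hs0.le, ENNReal.toReal_mul,
    finrank_euclideanSpace_fin, ENNReal.toReal_ofReal (by positivity), ← measureReal_closedBall hn]
  rfl

lemma centroidRatio_closedBall (hn : 1 ≤ n) {p : ℝ} (hp : 1 < p) :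
    centroidRatio p (Metric.closedBall (0 : EuclideanSpace ℝ (Fin n)) 1) ^ (-(p / (n : ℝ))) =
      (a₁ n p)⁻¹ := by
  have hn' : (0 : ℝ) < n := by exact_mod_cast hn
  have hp0 : 0 < p := by linarith
  have hκ := sphereMoment_pos hn hp
  have hω := omega_pos (k := n) (by linarith)
  have hκ' : 0 < sphereMoment n p / (n + p) := by positivity
  rw [centroidRatio, volume_centroidBody_closedBall hn hp, measureReal_closedBall hn,
    finrank_euclideanSpace_fin, Real.rpow_neg (by positivity), a₁_eq hn hp]
  congr 1
  rw [Real.div_rpow (by positivity) (by positivity), Real.mul_rpow (by positivity) hω.le,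
    ← Real.rpow_natCast, ← Real.rpow_mul hκ'.le, ← Real.rpow_mul hκ'.le, ← Real.rpow_mul hω.le,
    mul_div_assoc, ← Real.rpow_sub hω, show 1 / p * n * (p / n) = 1 by field_simp, Real.rpow_one,
    show p / (n : ℝ) - (n + p) / p * (p / n) = -1 by field_simp; ring, Real.rpow_neg_one]
  field_simp

end Ball

/-! ### Reduction to the centroid inequality, and the equality case -/

section Main

variable {n : ℕ} {f : EuclideanSpace ℝ (Fin n) → ℝ}

/-- Only the last factor depends on the shape of the unit ball beyond its volume. The first factor
reappears in `a₂_mul_Z_rpow`, so comparing the two sides is comparing centroid ratios. -/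
lemma volume_K_rpow (hn : 1 ≤ n) {p q : ℝ} (hpq : p.HolderConjugate q)
    (hf : ContDiff ℝ (⊤ : ℕ∞) f) (hs : HasCompactSupport f) (hf0 : f ≠ 0) :
    volume.real (K p f) ^ (-(p / (n : ℝ))) * (∫ x, CStar p f (gradient f x)) =
      (ell p q * n / (n + p) *
        volume.real (unitBody (dirSeminorm hpq.lt hf hs)) ^ (-(p / (n : ℝ)))) *
        centroidRatio p (unitBody (dirSeminorm hpq.lt hf hs)) ^ (-(p / (n : ℝ))) := by
  have hn' : (0 : ℝ) < n := by exact_mod_cast hn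
  have hp := hpq.lt
  have hp0 := hpq.pos
  have hq0 := hpq.symm.pos
  have hL := dirSeminorm_pos hp hf hs hf0
  have hA := isCompact_unitBody hL
  have hA0 := unitBody_mem_nhds (dirSeminorm hp hf hs)
  have hV := measureReal_pos_of_mem_nhds hA hA0
  have hC := measureReal_pos_of_mem_nhds (isCompact_centroidBody hp hA)
    (centroidBody_mem_nhds hp hA hA0)
  rw [volume_K hn hpq hf hs hf0, integral_CStar_gradient hn hp hf hs hf0, centroidRatio,
    finrank_euclideanSpace_fin]
  set V := volume.real (unitBody (dirSeminorm hp hf hs))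
  set C := volume.real (centroidBody p (unitBody (dirSeminorm hp hf hs)))
  rw [Real.mul_rpow (by positivity) hC.le, Real.div_rpow hC.le (by positivity),
    ← Real.rpow_mul hV.le, ← Real.rpow_natCast, ← Real.rpow_mul (by positivity),
    show (n : ℝ) * -(p / n) = -p by field_simp,
    Real.mul_rpow (by positivity) (by positivity), Real.mul_rpow (by positivity) (by positivity),
    ← Real.rpow_mul hq0.le, ← Real.rpow_mul hp0.le, ← Real.rpow_mul (by positivity),
    show 1 / q * -p = -(p / q) by ring, show 1 / p * -p = -1 by field_simp,
    Real.rpow_neg_one, Real.rpow_neg_one, ell,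
    show ((n : ℝ) + p) / p * -(p / n) = -(p / n) - 1 by field_simp; ring,
    Real.rpow_sub hV, Real.rpow_one]
  field_simp

lemma a₂_mul_Z_rpow (hn : 1 ≤ n) {p q : ℝ} (hpq : p.HolderConjugate q)
    (hf : ContDiff ℝ (⊤ : ℕ∞) f) (hs : HasCompactSupport f) (hf0 : f ≠ 0) :
    a₂ n p q * Z p f ^ p =
      (ell p q * n / (n + p) *
        volume.real (unitBody (dirSeminorm hpq.lt hf hs)) ^ (-(p / (n : ℝ)))) * (a₁ n p)⁻¹ := by
  have hn' : (0 : ℝ) < n := by exact_mod_cast hn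
  have hp := hpq.lt
  have hp0 := hpq.pos
  have hL := dirSeminorm_pos hp hf hs hf0
  have hV := measureReal_pos_of_mem_nhds (isCompact_unitBody hL) (unitBody_mem_nhds _)
  have ha : 0 < a₁ n p := by
    have := sphereMoment_pos hn hp
    have := omega_pos (k := n) (by linarith)
    rw [a₁_eq hn hp]
    positivity
  rw [Z]
  simp only [dirNorm_eq hp hf hs]
  rw [sphereIntegral_rpow_neg hn hL, ← Real.rpow_mul (by positivity),
    show -(1 / (n : ℝ)) * p = -(p / n) by ring, Real.mul_rpow hn'.le hV.le, a₂,
    show ((n : ℝ) + p) / n = 1 + p / n by field_simp, Real.rpow_add hn', Real.rpow_one,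
    Real.rpow_neg hn'.le]
  have : (n : ℝ) ^ (p / (n : ℝ)) ≠ 0 := by positivity
  field_simp

/-- A linear isomorphism turning a norm into the Euclidean norm may be chosen with positive
determinant. -/
lemma exists_det_pos (hn : 1 ≤ n) {L : EuclideanSpace ℝ (Fin n) → ℝ}
    (T : EuclideanSpace ℝ (Fin n) ≃ₗ[ℝ] EuclideanSpace ℝ (Fin n)) (hT : ∀ x, L (T x) = ‖x‖) :
    ∃ T' : EuclideanSpace ℝ (Fin n) ≃ₗ[ℝ] EuclideanSpace ℝ (Fin n),
      0 < LinearMap.det T'.toLinearMap ∧ ∀ x, L (T' x) = ‖x‖ := by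
  rcases lt_or_gt_of_ne (LinearEquiv.isUnit_det' T).ne_zero with h | h
  -- A hyperplane reflection has determinant -1 and preserves the Euclidean norm, so composing with
  -- it corrects the sign.
  · set e : EuclideanSpace ℝ (Fin n) := EuclideanSpace.single ⟨0, hn⟩ 1
    have he : e ≠ 0 := by simp [e]
    set ρ := (ℝ ∙ e)ᗮ.reflection
    have hρ : LinearMap.det ρ.toLinearEquiv.toLinearMap = -1 := by
      have := Submodule.det_reflection (ℝ ∙ e)ᗮ
      rw [Submodule.orthogonal_orthogonal, finrank_span_singleton he, pow_one] at this
      exact this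
    refine ⟨ρ.toLinearEquiv.trans T, ?_, fun x => ?_⟩
    · rw [LinearEquiv.coe_trans, LinearMap.det_comp, hρ]
      linarith
    · exact (hT (ρ x)).trans (ρ.norm_map x)
  · exact ⟨T, h, hT⟩

lemma inner_gradient_comp (hf : ContDiff ℝ (⊤ : ℕ∞) f)
    (T : EuclideanSpace ℝ (Fin n) ≃ₗ[ℝ] EuclideanSpace ℝ (Fin n))
    (x v : EuclideanSpace ℝ (Fin n)) :
    inner ℝ (gradient (fun y => f (T y)) x) v = inner ℝ (gradient f (T x)) (T v) := by
  rw [inner_gradient_eq_fderiv, inner_gradient_eq_fderiv]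
  have h1 : HasFDerivAt f (fderiv ℝ f (T x)) (T x) :=
    (hf.differentiable (by simp) _).hasFDerivAt
  have h2 : HasFDerivAt T (T.toContinuousLinearEquiv : _ →L[ℝ] _) x :=
    T.toContinuousLinearEquiv.hasFDerivAt
  have h3 : HasFDerivAt (fun y => f (T y)) _ x := h1.comp x h2
  rw [h3.fderiv]
  rfl

/-- The `L^p` norm of the gradient after a change of variables making the directional
norms of the gradient Euclidean. -/
lemma integral_norm_gradient_comp (hn : 1 ≤ n) {p : ℝ} (hp : 1 < p)
    (hf : ContDiff ℝ (⊤ : ℕ∞) f) (hs : HasCompactSupport f)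
    (T : EuclideanSpace ℝ (Fin n) ≃ₗ[ℝ] EuclideanSpace ℝ (Fin n))
    (hdet : 0 < LinearMap.det T.toLinearMap) (hT : ∀ x, dirSeminorm hp hf hs (T x) = ‖x‖) :
    ∫ x, ‖gradient (fun y => f (T y)) x‖ ^ p =
      (LinearMap.det T.toLinearMap)⁻¹ * (n * omega n / sphereMoment n p) := by
  have hg : ContDiff ℝ (⊤ : ℕ∞) fun y => f (T y) :=
    hf.comp T.toContinuousLinearEquiv.contDiff
  have hgs : HasCompactSupport fun y => f (T y) :=
    hs.comp_homeomorph T.toContinuousLinearEquiv.toHomeomorph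
  have hdir : ∀ z, dirSeminorm hp hg hgs z ^ p = (LinearMap.det T.toLinearMap)⁻¹ * ‖z‖ ^ p := by
    intro z
    rw [dirSeminorm_rpow, ← hT, dirSeminorm_rpow]
    simp only [inner_gradient_comp hf T]
    rw [integral_comp_linear T (fun x => |inner ℝ (gradient f x) (T z)| ^ p), smul_eq_mul,
      abs_of_pos hdet]
  -- Fubini over the Euclidean ball: its moments are a constant times ‖·‖^p, so the left side is a
  -- multiple of the integral sought, while the right side is explicit by `hdir`.
  have h1 := integral_moment_gradient hp hg hgs
    (isCompact_closedBall (0 : EuclideanSpace ℝ (Fin n)) 1)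
  simp only [hdir, moment_closedBall hn hp] at h1
  rw [integral_const_mul, integral_const_mul] at h1
  have h2 := setIntegral_seminorm_rpow hn hp (normSeminorm_pos (n := n))
  rw [unitBody_normSeminorm, measureReal_closedBall hn] at h2
  simp only [coe_normSeminorm] at h2
  rw [h2] at h1
  have hκ := sphereMoment_pos hn hp
  have hnp : (0 : ℝ) < n + p := by positivity
  field_simp at h1 ⊢
  linarith

/-- The unit ball is the image of the Euclidean ball under `T`, so its volume is det T · ω_n. The
constant `c` is normalized so that only a power of det T and the constant of
`integral_norm_gradient_comp` remain. -/
lemma affineEnergy_rpow (hn : 1 ≤ n) {p : ℝ} (hp : 1 < p)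
    (hf : ContDiff ℝ (⊤ : ℕ∞) f) (hs : HasCompactSupport f) (hf0 : f ≠ 0)
    (T : EuclideanSpace ℝ (Fin n) ≃ₗ[ℝ] EuclideanSpace ℝ (Fin n))
    (hdet : 0 < LinearMap.det T.toLinearMap) (hT : ∀ x, dirSeminorm hp hf hs (T x) = ‖x‖) :
    affineEnergy p f ^ p =
      LinearMap.det T.toLinearMap ^ (-(p / (n : ℝ))) * (n * omega n / sphereMoment n p) := by
  have hn' : (0 : ℝ) < n := by exact_mod_cast hn
  have hp0 : 0 < p := by linarith
  have hL := dirSeminorm_pos hp hf hs hf0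
  have hω := omega_pos (k := n) (by linarith)
  have hω1 := omega_pos (k := n + p - 2) (by linarith [(by exact_mod_cast hn : (1:ℝ) ≤ n)])
  have hω2 := omega_pos (k := p - 1) (by linarith)
  have hball : volume.real (unitBody (dirSeminorm hp hf hs)) =
      LinearMap.det T.toLinearMap * omega n := by
    have h := measureReal_preimage_linear T (unitBody (dirSeminorm hp hf hs))
    have hset : T ⁻¹' unitBody (dirSeminorm hp hf hs) = Metric.closedBall 0 1 := by
      ext x
      simp [unitBody, hT]
    rw [hset, measureReal_closedBall hn, abs_of_pos hdet] at h
    rw [h, mul_inv_cancel_left₀ hdet.ne']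
  rw [affineEnergy]
  simp only [dirNorm_eq hp hf hs]
  rw [sphereIntegral_rpow_neg hn hL, hball, c, Real.mul_rpow (by positivity) (by positivity),
    Real.mul_rpow (by positivity) (by positivity), ← Real.rpow_mul (by positivity),
    ← Real.rpow_mul (by positivity), ← Real.rpow_mul (by positivity),
    show 1 / p * p = 1 by field_simp, Real.rpow_one, show 1 / (n : ℝ) * p = p / n by ring,
    show -(1 / (n : ℝ)) * p = -(p / n) by ring, mul_left_comm (n : ℝ),
    Real.mul_rpow hdet.le (by positivity), Real.rpow_neg (by positivity : 0 ≤ n * omega n),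
    sphereMoment]
  have h1 : (n * omega n : ℝ) ^ (p / (n : ℝ)) ≠ 0 := by positivity
  field_simp

end Main

end AffineSobolev

theorem mainTheorem4 (n : ℕ) (hn : 1 ≤ n) (p q : ℝ) (hp : 1 < p) (hpq : 1 / p + 1 / q = 1)
    (f : EuclideanSpace ℝ (Fin n) → ℝ) (hf : ContDiff ℝ (⊤ : ℕ∞) f)
    (hsupp : HasCompactSupport f) (hf0 : f ≠ 0) :
    (volume (AffineSobolev.K p f)).toReal ^ (-(p / (n : ℝ))) *
        (∫ x, AffineSobolev.CStar p f (gradient f x))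
      ≤ AffineSobolev.a₂ n p q * AffineSobolev.Z p f ^ p ∧
    ((volume (AffineSobolev.K p f)).toReal ^ (-(p / (n : ℝ))) *
        (∫ x, AffineSobolev.CStar p f (gradient f x))
      = AffineSobolev.a₂ n p q * AffineSobolev.Z p f ^ p →
      ∃ M : Matrix (Fin n) (Fin n) ℝ, 0 < M.det ∧
        AffineSobolev.affineEnergy p f ^ p =
          M.det ^ ((p - n) / (n : ℝ)) *
            ∫ x, ‖gradient (fun y => f (Matrix.toEuclideanLin M⁻¹ y)) x‖ ^ p) := by
  have hpq' : p.HolderConjugate q :=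
    Real.holderConjugate_iff.2 ⟨hp, by simpa [one_div] using hpq⟩
  have hn' : (0 : ℝ) < n := by exact_mod_cast hn
  have hL := AffineSobolev.dirSeminorm_pos hp hf hsupp hf0
  have hA := AffineSobolev.isCompact_unitBody hL
  have hA0 := AffineSobolev.unitBody_mem_nhds (AffineSobolev.dirSeminorm hp hf hsupp)
  have hV := AffineSobolev.measureReal_pos_of_mem_nhds hA hA0
  have hJ := AffineSobolev.centroidRatio_pos hp hA hA0
  have hball0 := Metric.closedBall_mem_nhds (0 : EuclideanSpace ℝ (Fin n)) one_pos
  have hJ₀ := AffineSobolev.centroidRatio_pos hp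
    (isCompact_closedBall (0 : EuclideanSpace ℝ (Fin n)) 1) hball0
  have hell : 0 < AffineSobolev.ell p q :=
    mul_pos (Real.rpow_pos_of_pos hpq'.symm.pos _) (inv_pos.2 hpq'.pos)
  have hfac : 0 < AffineSobolev.ell p q * n / (n + p) *
      volume.real (AffineSobolev.unitBody (AffineSobolev.dirSeminorm hpq'.lt hf hsupp)) ^
        (-(p / (n : ℝ))) :=
    mul_pos (div_pos (mul_pos hell hn') (by linarith)) (Real.rpow_pos_of_pos hV _)
  change volume.real (AffineSobolev.K p f) ^ (-(p / (n : ℝ))) * _ ≤ _ ∧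
    (volume.real (AffineSobolev.K p f) ^ (-(p / (n : ℝ))) * _ = _ → _)
  rw [AffineSobolev.volume_K_rpow hn hpq' hf hsupp hf0,
    AffineSobolev.a₂_mul_Z_rpow hn hpq' hf hsupp hf0, ← AffineSobolev.centroidRatio_closedBall hn hp]
  -- The exponent -p/n is negative, so the lower bound on the centroid ratio becomes an upper bound.
  refine ⟨mul_le_mul_of_nonneg_left (Real.rpow_le_rpow_of_nonpos hJ₀
    (AffineSobolev.centroidRatio_closedBall_le hp _ hL)
    (neg_nonpos.2 (div_pos (by linarith) hn').le)) hfac.le, fun heq => ?_⟩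
  have hJeq := (Real.rpow_left_inj hJ.le hJ₀.le
    (neg_ne_zero.2 (div_pos (by linarith) hn').ne')).1 (mul_left_cancel₀ hfac.ne' heq)
  obtain ⟨T₀, hT₀⟩ := AffineSobolev.exists_linear_of_centroidRatio_eq hp _ hL hJeq
  obtain ⟨T, hdet, hT⟩ := AffineSobolev.exists_det_pos hn T₀ hT₀
  set d := LinearMap.det T.toLinearMap with hd
  set N : Matrix (Fin n) (Fin n) ℝ := Matrix.toEuclideanLin.symm T.toLinearMap
  have hTN : Matrix.toEuclideanLin N = T.toLinearMap := LinearEquiv.apply_symm_apply _ _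
  have hNdet : N.det = d := by
    rw [hd, ← hTN]
    exact (LinearMap.det_toLin (PiLp.basisFun 2 ℝ (Fin n)) N).symm
  -- With M = N⁻¹ the function g is f ∘ T, and the two powers of det T combine through -(p-n)/n - 1
  -- = -p/n.
  refine ⟨N⁻¹, ?_, ?_⟩
  · rw [Matrix.det_nonsing_inv, hNdet, Ring.inverse_eq_inv']
    exact inv_pos.2 hdet
  · rw [Matrix.nonsing_inv_nonsing_inv _ (by rw [hNdet]; exact hdet.ne'.isUnit), hTN,
      Matrix.det_nonsing_inv, hNdet, Ring.inverse_eq_inv',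
      AffineSobolev.affineEnergy_rpow hn hp hf hsupp hf0 T hdet hT]
    have h := AffineSobolev.integral_norm_gradient_comp hn hp hf hsupp T hdet hT
    simp only [LinearEquiv.coe_coe]
    rw [h, ← mul_assoc, ← hd, Real.inv_rpow hdet.le, ← Real.rpow_neg hdet.le,
      ← Real.rpow_neg_one d, ← Real.rpow_add hdet]
    congr 2
    field_simp
    ring
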